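/- Let $K$ be a field, $n\ge 0$ and $R=K[x_1,\dots,x_n]$. For a homogeneous ideal $I\subseteq R$ let $\beta^I_{i,j}$ be the graded Betti numbers of $R/I$ (the number of copies of $R(-j)$ in homological degree $i$ of a minimal graded free resolution of $R/I$), and let $H(R/I,t)=\dim_K (R/I)_t$ be its Hilbert function. The Hilbert function corresponding to an $f$-vector $(f_0,\dots,f_{n-1})$ is $H(0)=1$, $H(m)=\sum_{i=0}^{n-1} f_i\binom{m-1}{i}$ for $m>0$. A squarefree monomial ideal $I\subseteq R$ is said to have the smallest graded Betti numbers if $\beta^I_{i,j}\le\beta^J_{i,j}$ for all $i,j$ and for every squarefree monomial ideal $J\subseteq R$ with $H(R/J,\cdot)=H(R/I,\cdot)$. Then: 1. For every $k$ with $0\le k\le n$ and $k\le\binom n2$ there is a squarefree monomial ideal $I$ such that $H(R/I,\cdot)$ is the Hilbert function corresponding to the $f$-vector $(n,k,0,\dots,0)$ and $I$ has the smallest graded Betti numbers. 2. If $0\le k\le n-1$, let $\Delta$ be the simplicial complex on $\{1,\dots,n\}$ whose nonempty faces are the $n$ vertices and the $k$ edges $\{1,2\},\{2,3\},\dots,\{k,k+1\}$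 of a path. Then $\Delta$ has $f$-vector $(n,k,0,\dots,0)$, and its Stanley–Reisner ideal $I_\Delta$ (generated by the squarefree monomials of the non-faces) has the corresponding Hilbert function, has the smallest graded Betti numbers, and has a $2$-linear resolution: $I_\Delta$ is generated by quadratic forms and $\beta^{I_\Delta}_{i,j}=0$ unless $i=j=0$ or $i\ge 1$ and $j=i+1$. 3. If $n\ge 3$, let $\Delta$ be the simplicial complex whose nonempty faces are the $n$ vertices and the $n$ edges $\{1,2\},\{2,3\},\dots,\{n-1,n\},\{n,1\}$ of an $n$-cycle. Then $\Delta$ has $f$-vector $(n,n,0,\dots,0)$, and its Stanley–Reisner ideal has the corresponding Hilbert function and the smallest graded Betti numbers. 4. If $n\ge 3$, the Hilbert functions corresponding to the $f$-vectors $(n,k,0,\dots,0)$, $0\le k\le n$, are $n+1$ distinct functions. -/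

import Mathlib

noncomputable section

open MvPolynomial

/-- A squarefree monomial ideal of `K[x_1, …, x_n]`: an ideal generated by products of distinct
variables. -/
def IsSquarefreeMonomialIdeal {K : Type*} [Field K] {n : ℕ}
    (I : Ideal (MvPolynomial (Fin n) K)) : Prop :=
  ∃ S : Set (Finset (Fin n)),
    I = Ideal.span ((fun s : Finset (Fin n) => ∏ v ∈ s, (X v : MvPolynomial (Fin n) K)) '' S)

/-- The degree `t` part of `R / I`: the image of the forms of degree `t`. -/
def gradedPiece {K : Type*} [Field K] {n : ℕ} (I : Ideal (MvPolynomial (Fin n) K)) (t : ℕ) :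
    Submodule K (MvPolynomial (Fin n) K ⧸ I) :=
  (homogeneousSubmodule (Fin n) K t).map (Ideal.Quotient.mkₐ K I).toLinearMap

/-- The Hilbert function `t ↦ dim_K (R / I)_t`. -/
def hilbertFunction {K : Type*} [Field K] {n : ℕ} (I : Ideal (MvPolynomial (Fin n) K)) :
    ℕ → ℕ :=
  fun t => Module.finrank K (gradedPiece I t)

/-- A minimal graded free resolution
`⋯ → F_2 → F_1 → F_0 → R / I → 0` of `R / I` over `R = K[x_1, …, x_n]`, where
`F_i` is free with a finite homogeneous basis whose elements have the degrees `deg i a`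
(that is, `F_i = ⨁_a R(-deg i a)`). -/
structure MinimalFreeResolution {K : Type*} [Field K] {n : ℕ}
    (I : Ideal (MvPolynomial (Fin n) K)) where
  /-- the rank of `F_i` -/
  rank : ℕ → ℕ
  /-- the degrees of the basis elements of `F_i` -/
  deg : (i : ℕ) → Fin (rank i) → ℕ
  /-- the augmentation `F_0 → R / I` -/
  aug : (Fin (rank 0) → MvPolynomial (Fin n) K) →ₗ[MvPolynomial (Fin n) K]
    (MvPolynomial (Fin n) K ⧸ I)
  /-- the differential `F_{i+1} → F_i` -/
  diff : (i : ℕ) → (Fin (rank (i + 1)) → MvPolynomial (Fin n) K) →ₗ[MvPolynomial (Fin n) K]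
    (Fin (rank i) → MvPolynomial (Fin n) K)
  /-- the augmentation preserves degrees -/
  aug_homogeneous : ∀ a, aug (Pi.single a 1) ∈ gradedPiece I (deg 0 a)
  /-- the differentials preserve degrees: the matrix entry from the basis element `b` to the basis
  element `a` is a form of degree `deg b - deg a`, and it is zero if this number is negative -/
  diff_homogeneous : ∀ i a b (s : Fin n →₀ ℕ),
    coeff s (diff i (Pi.single b 1) a) ≠ 0 → s.degree + deg i a = deg (i + 1) b
  aug_surjective : Function.Surjective aug
  exact_zero : LinearMap.range (diff 0) = LinearMap.ker aug
  exact_succ : ∀ i, LinearMap.range (diff (i + 1)) = LinearMap.ker (diff i)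
  /-- minimality: no matrix entry has a nonzero constant term, so that the image of each
  differential lies in `(x_1, …, x_n) F_i` -/
  minimal : ∀ i a b, constantCoeff (diff i (Pi.single b 1) a) = 0

/-- The number of copies of `R(-j)` in `F_i`. -/
def MinimalFreeResolution.betti {K : Type*} [Field K] {n : ℕ}
    {I : Ideal (MvPolynomial (Fin n) K)} (F : MinimalFreeResolution I) (i j : ℕ) : ℕ :=
  (Finset.univ.filter fun a : Fin (F.rank i) => F.deg i a = j).card

open Classical in
/-- The graded Betti number `β_{i,j}` of `R / I`, read off from a minimal graded free resolution.
For a homogeneous ideal a minimal graded free resolution exists, and any two are isomorphic, so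
that the choice does not matter. -/
def gradedBetti {K : Type*} [Field K] {n : ℕ} (I : Ideal (MvPolynomial (Fin n) K))
    (i j : ℕ) : ℕ :=
  if h : Nonempty (MinimalFreeResolution I) then h.some.betti i j else 0

/-- `I` has the smallest graded Betti numbers, in the entrywise order, among all squarefree
monomial ideals with the Hilbert function of `I` (and is itself one of these ideals). -/
def HasLeastGradedBetti {K : Type*} [Field K] {n : ℕ}
    (I : Ideal (MvPolynomial (Fin n) K)) : Prop :=
  IsSquarefreeMonomialIdeal I ∧
    ∀ J : Ideal (MvPolynomial (Fin n) K), IsSquarefreeMonomialIdeal J →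
      hilbertFunction J = hilbertFunction I → ∀ i j, gradedBetti I i j ≤ gradedBetti J i j

/-- `I` is generated by `q`-forms and the minimal free resolution of `R / I` is `q`-linear:
besides `β_{0,0}`, only the `β_{i,q+i-1}` with `1 ≤ i` can be nonzero. -/
def HasLinearResolution {K : Type*} [Field K] {n : ℕ}
    (I : Ideal (MvPolynomial (Fin n) K)) (q : ℕ) : Prop :=
  (∃ S : Set (MvPolynomial (Fin n) K), (∀ p ∈ S, p.IsHomogeneous q) ∧ I = Ideal.span S) ∧
    ∀ i j, ¬(i = 0 ∧ j = 0) → ¬(1 ≤ i ∧ j + 1 = q + i) → gradedBetti I i j = 0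

/-- The `f`-vector `(f_0, …, f_{n-1})` of a simplicial complex on `n` vertices: `f_i` is the
number of faces with `i + 1` vertices. -/
def fVector {n : ℕ} (Δ : AbstractSimplicialComplex (Fin n)) : Fin n → ℕ :=
  fun i => {s : Finset (Fin n) | s ∈ Δ.faces ∧ s.card = i.val + 1}.ncard

/-- The Hilbert function that corresponds to the `f`-vector `(f_0, …, f_{n-1})`. -/
def hilbertOfFVector {n : ℕ} (f : Fin n → ℕ) : ℕ → ℕ :=
  fun m => if m = 0 then 1 else ∑ i : Fin n, f i * (m - 1).choose i.val

/-- The vector `(n, k, 0, …, 0)` with `n` entries. -/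
def nkVector (n k : ℕ) : Fin n → ℕ :=
  fun i => if i.val = 0 then n else if i.val = 1 then k else 0

/-- The Stanley–Reisner ideal of `Δ`, generated by the monomials of the non-faces. (The faces of
an `AbstractSimplicialComplex` are nonempty sets; the empty set always counts as a face here.) -/
def stanleyReisnerIdeal (K : Type*) [Field K] {n : ℕ} (Δ : AbstractSimplicialComplex (Fin n)) :
    Ideal (MvPolynomial (Fin n) K) :=
  Ideal.span ((fun s : Finset (Fin n) => ∏ v ∈ s, (X v : MvPolynomial (Fin n) K)) ''
    {s | s.Nonempty ∧ s ∉ Δ.faces})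

/-- A graph as a simplicial complex of dimension at most one: its faces are all the vertices and
the edges. -/
def graphComplex {n : ℕ} (G : SimpleGraph (Fin n)) : AbstractSimplicialComplex (Fin n) where
  faces := {s | (∃ v, s = {v}) ∨ ∃ u v, G.Adj u v ∧ s = {u, v}}
  isRelLowerSet_faces := by
    rintro s (⟨v, rfl⟩ | ⟨u, v, h, rfl⟩)
    · refine ⟨Finset.singleton_nonempty v, fun t hts ht => Or.inl ⟨v, ?_⟩⟩
      exact (Finset.subset_singleton_iff.mp hts).resolve_left ht.ne_empty
    · refine ⟨Finset.insert_nonempty _ _, fun t hts ht => ?_⟩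
      by_cases hu : u ∈ t
      · by_cases hv : v ∈ t
        · refine Or.inr ⟨u, v, h, Finset.Subset.antisymm hts ?_⟩
          intro w hw
          simp only [Finset.mem_insert, Finset.mem_singleton] at hw
          rcases hw with rfl | rfl <;> assumption
        · refine Or.inl ⟨u, Finset.Subset.antisymm ?_ (by simpa using hu)⟩
          intro w hw
          have hw' := hts hw
          simp only [Finset.mem_insert, Finset.mem_singleton] at hw' ⊢
          rcases hw' with rfl | rfl
          · rfl
          · exact absurd hw hv
      · refine Or.inl ⟨v, ?_⟩
        refine (Finset.subset_singleton_iff.mp ?_).resolve_left ht.ne_empty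
        intro w hw
        have hw' := hts hw
        simp only [Finset.mem_insert, Finset.mem_singleton] at hw' ⊢
        rcases hw' with rfl | rfl
        · exact absurd hw hu
        · rfl
  singleton_mem v := Or.inl ⟨v, rfl⟩

/-- The graph on `n` vertices with the `k` edges `{1,2}, {2,3}, …, {k,k+1}` (numbered from `0` in
the code), for `k < n`; the other vertices are isolated. -/
def pathWithEdges (n k : ℕ) : SimpleGraph (Fin n) where
  Adj u v := (u.val + 1 = v.val ∧ v.val ≤ k) ∨ (v.val + 1 = u.val ∧ u.val ≤ k)
  symm := ⟨fun _ _ h => h.symm⟩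
  loopless := ⟨fun _ h => by omega⟩

end

/-! The graded Betti number `β_{i,j}` of `R/I` is the dimension of the Koszul homology of `R/I` in
homological degree `i` and degree `j`. For a squarefree monomial ideal with complex `Δ` this
homology splits by multidegree, and only squarefree multidegrees `W` contribute. Hochster's formula
results: `β_{i,j}` is the sum over `|W| = j` of the dimensions of the reduced cohomology of the
induced complex `Δ_W` in degree `j - i - 1`. Only one consequence is needed: if the strands are
exact, then `β_{i,j} = 0` (`IsFaceSet.koszulExact`, `MinimalFreeResolution.betti_eq_zero`).

A Hilbert function of the given kind forces every competitor to come from a graph with all `n`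
vertices (`IsFaceSet.isGraphIdeal`). Apart from `(0,0)`, Betti numbers then occur only for `j = i +
1` (disconnected induced subgraphs) and `j = i + 2` (cycles in induced subgraphs). The Hilbert
function also fixes every alternating sum of the `β_{i,j}` over `i` (`alternating_betti_eq`), so for
each `j ≥ 2` the difference `β_{j-2,j} - β_{j-1,j}` is the same for all competitors. An ideal for
which one of these two numbers vanishes for each `j` is therefore least
(`IsGraphIdeal.gradedBetti_le`).

Induced subgraphs of a path are forests, so `β_{j-2,j} = 0` always. For a cycle the same holds for
proper induced subgraphs, that is for `j ≠ n`; for `j = n` the whole cycle is connected, so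
`β_{n-1,n} = 0`. -/

noncomputable section

open MvPolynomial

/-! ### Signed complexes on families of sets -/

/-- The sign of the insertion of `v` into the ordered set `S`. -/
def insertSign {n : ℕ} (v : Fin n) (S : Finset (Fin n)) : ℤ :=
  (-1) ^ (S.filter (· < v)).card

theorem insertSign_mul_self {n : ℕ} (v : Fin n) (S : Finset (Fin n)) :
    insertSign v S * insertSign v S = 1 := by
  unfold insertSign
  rw [← mul_pow]; norm_num

theorem insertSign_empty {n : ℕ} (v : Fin n) : insertSign v ∅ = 1 := by
  simp [insertSign]

theorem insertSign_insert {n : ℕ} {u v : Fin n} {S : Finset (Fin n)} (hu : u ∉ S) :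
    insertSign v (insert u S) = if u < v then -insertSign v S else insertSign v S := by
  unfold insertSign
  rw [Finset.filter_insert]
  split_ifs with h
  · rw [Finset.card_insert_of_notMem (by simp [hu]), pow_succ]; ring
  · rfl

/-- Exactly one of the two signs changes when the other vertex is inserted first. This
anticommutation makes the differentials below square to zero. -/
theorem insertSign_swap {n : ℕ} {u v : Fin n} {S : Finset (Fin n)} (huv : u ≠ v)
    (hu : u ∉ S) (hv : v ∉ S) :
    insertSign v S * insertSign u (insert v S) = -(insertSign u S * insertSign v (insert u S)) := by
  rw [insertSign_insert hu, insertSign_insert hv]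
  rcases lt_or_gt_of_ne huv with h | h
  · simp [h, not_lt_of_gt h]; ring
  · simp [h, not_lt_of_gt h]; ring

/-- Exactness, at the sets with `i` elements, of the complex of functions on a family of sets
with the differential `(dφ)(T) = ∑_{v ∉ T} ± φ(T ∪ {v})`. -/
def ExactAt (K : Type*) [Field K] {n : ℕ} (𝓢 : Set (Finset (Fin n))) (i : ℕ) : Prop :=
  ∀ φ : Finset (Fin n) → K, (∀ S, φ S ≠ 0 → S ∈ 𝓢 ∧ S.card = i) →
    (∀ T ∈ 𝓢, ∑ v ∈ Tᶜ, insertSign v T • φ (insert v T) = 0) →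
    ∃ ψ : Finset (Fin n) → K, (∀ S, ψ S ≠ 0 → S ∈ 𝓢 ∧ S.card = i + 1) ∧
      ∀ S ∈ 𝓢, ∑ v ∈ Sᶜ, insertSign v S • ψ (insert v S) = φ S

theorem exactAt_of_card_ne {K : Type*} [Field K] {n : ℕ} {𝓢 : Set (Finset (Fin n))} {i : ℕ}
    (h : ∀ S ∈ 𝓢, S.card ≠ i) : ExactAt K 𝓢 i := by
  intro φ hφ _
  refine ⟨0, by simp, fun S hS => ?_⟩
  by_contra hne
  exact h S hS (hφ S (by simpa using Ne.symm hne)).2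

/-- A family that is closed under adding and removing `v` has an exact complex. -/
theorem exactAt_of_toggle {K : Type*} [Field K] {n : ℕ} {𝓢 : Set (Finset (Fin n))} (v : Fin n)
    (hins : ∀ S ∈ 𝓢, insert v S ∈ 𝓢) (hera : ∀ S ∈ 𝓢, S.erase v ∈ 𝓢) (i : ℕ) :
    ExactAt K 𝓢 i := by
  classical
  intro φ hφ hcyc
  -- The contracting homotopy attached to `v`. At sets containing `v` it inverts the differential by
  -- the cycle condition at `S.erase v`; at the others only the summand of `v` survives.
  refine ⟨fun S => if v ∈ S then insertSign v (S.erase v) • φ (S.erase v) else 0, ?_, ?_⟩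
  · intro S hS
    by_cases hv : v ∈ S
    · simp only [hv, if_true] at hS
      have h1 := hφ (S.erase v) (fun h => hS (by simp [h]))
      refine ⟨?_, ?_⟩
      · have := hins _ h1.1
        rwa [Finset.insert_erase hv] at this
      · rw [← h1.2, Finset.card_erase_add_one hv]
    · simp [hv] at hS
  · intro S hS
    by_cases hv : v ∈ S
    · have hT := hcyc (S.erase v) (hera S hS)
      have hcompl : (S.erase v)ᶜ = insert v Sᶜ := by
        ext x; simp only [Finset.mem_compl, Finset.mem_erase, Finset.mem_insert]; tauto
      rw [hcompl, Finset.sum_insert (by simpa using hv), Finset.insert_erase hv] at hT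
      have key : ∑ u ∈ Sᶜ, insertSign u S • (if v ∈ insert u S then
          insertSign v ((insert u S).erase v) • φ ((insert u S).erase v) else 0) =
          -(insertSign v (S.erase v) •
            ∑ u ∈ Sᶜ, insertSign u (S.erase v) • φ (insert u (S.erase v))) := by
        rw [Finset.smul_sum, ← Finset.sum_neg_distrib]
        refine Finset.sum_congr rfl fun u hu => ?_
        have hu' : u ∉ S := by simpa using hu
        have huv : u ≠ v := by rintro rfl; exact hu' hv
        rw [if_pos (Finset.mem_insert_of_mem hv), Finset.erase_insert_of_ne huv, smul_smul,
          smul_smul, ← neg_smul]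
        congr 1
        have hs := insertSign_swap (S := S.erase v) (u := u) (v := v) huv
          (by simp [hu']) (by simp)
        rw [Finset.insert_erase hv] at hs
        have h1 := insertSign_mul_self v (S.erase v)
        have h2 := insertSign_mul_self u (S.erase v)
        linear_combination (insertSign v (S.erase v) * insertSign v (insert u (S.erase v))) * hs
          - insertSign u S * insertSign v (insert u (S.erase v)) * h1
          - insertSign v (S.erase v) * insertSign u (S.erase v) *
            insertSign_mul_self v (insert u (S.erase v))
      rw [key]
      have h3 : ∑ u ∈ Sᶜ, insertSign u (S.erase v) • φ (insert u (S.erase v)) =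
          -(insertSign v (S.erase v) • φ S) := by
        rw [eq_neg_iff_add_eq_zero, add_comm]; exact hT
      rw [h3, smul_neg, neg_neg, smul_smul, insertSign_mul_self, one_smul]
    · rw [Finset.sum_eq_single_of_mem v (by simpa using hv)]
      · beta_reduce
        rw [if_pos (Finset.mem_insert_self _ _), Finset.erase_insert hv, smul_smul,
          insertSign_mul_self, one_smul]
      · intro u _ huv
        beta_reduce
        rw [if_neg (by simp [hv, huv.symm]), smul_zero]

/-! ### The Koszul complex and its multigraded strands -/

/-- The Koszul differential of the variables with coefficients in `M`; the component at `S` of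
an element of the Koszul complex is the coefficient of the exterior product of the `e_v`,
`v ∈ S`. -/
def koszul {K : Type*} [Field K] {n : ℕ} {M : Type*} [AddCommGroup M]
    [Module (MvPolynomial (Fin n) K) M] (ω : Finset (Fin n) → M) (T : Finset (Fin n)) : M :=
  ∑ v ∈ Tᶜ, insertSign v T • (X v : MvPolynomial (Fin n) K) • ω (insert v T)

section koszul
variable {K : Type*} [Field K] {n : ℕ} {M N : Type*} [AddCommGroup M]
    [Module (MvPolynomial (Fin n) K) M] [AddCommGroup N] [Module (MvPolynomial (Fin n) K) N]

theorem koszul_add (ω η : Finset (Fin n) → M) :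
    koszul (K := K) (ω + η) = koszul (K := K) ω + koszul (K := K) η := by
  funext T; simp [koszul, Finset.sum_add_distrib]

theorem map_koszul (f : M →ₗ[MvPolynomial (Fin n) K] N) (ω : Finset (Fin n) → M)
    (T : Finset (Fin n)) : f (koszul (K := K) ω T) = koszul (K := K) (fun S => f (ω S)) T := by
  simp [koszul]

theorem koszul_koszul (ω : Finset (Fin n) → M) : koszul (K := K) (koszul (K := K) ω) = 0 := by
  classical
  funext T
  simp only [koszul, Finset.smul_sum, Pi.zero_apply]
  rw [Finset.sum_sigma']
  refine Finset.sum_involution (fun p _ => ⟨p.2, p.1⟩) ?_ ?_ ?_ ?_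
  · rintro ⟨v, u⟩ h
    simp only [Finset.mem_sigma, Finset.mem_compl, Finset.mem_insert, not_or] at h
    obtain ⟨hv, huv, hu⟩ := h
    dsimp only
    rw [Finset.insert_comm v u T, smul_comm (X v) (insertSign u _), smul_comm (X u) (insertSign v _),
      smul_smul, smul_smul, insertSign_swap huv hu hv, neg_smul, smul_smul (insertSign u T),
      smul_smul (X u), mul_comm (X u), neg_add_cancel]
  · rintro ⟨v, u⟩ h _ he
    simp only [Finset.mem_sigma, Finset.mem_compl, Finset.mem_insert, not_or] at h
    simp only [Sigma.mk.injEq] at he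
    exact h.2.1 he.1
  · rintro ⟨v, u⟩ h
    simp only [Finset.mem_sigma, Finset.mem_compl, Finset.mem_insert, not_or] at h ⊢
    exact ⟨h.2.2, fun h' => h.2.1 h'.symm, h.1⟩
  · rintro ⟨v, u⟩ h
    rfl
end koszul

theorem coeff_koszul {K : Type*} [Field K] {n : ℕ} (q : Finset (Fin n) → MvPolynomial (Fin n) K)
    (T : Finset (Fin n)) (b : Fin n →₀ ℕ) :
    coeff b (koszul (K := K) q T) = ∑ v ∈ Tᶜ, insertSign v T •
      (if v ∈ b.support then coeff (b - Finsupp.single v 1) (q (insert v T)) else 0) := by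
  rw [koszul, coeff_sum]
  refine Finset.sum_congr rfl fun v _ => ?_
  rw [← coeff_X_mul', smul_eq_mul]
  exact map_zsmul (coeffAddMonoidHom b) _ _

/-- The exponent vector of the squarefree monomial of `S`. -/
def indicatorVec {n : ℕ} (S : Finset (Fin n)) : Fin n →₀ ℕ :=
  ∑ v ∈ S, Finsupp.single v 1

theorem indicatorVec_insert {n : ℕ} {v : Fin n} {S : Finset (Fin n)} (hv : v ∉ S) :
    indicatorVec (insert v S) = Finsupp.single v 1 + indicatorVec S :=
  Finset.sum_insert hv

theorem indicatorVec_apply {n : ℕ} (S : Finset (Fin n)) (v : Fin n) :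
    indicatorVec S v = if v ∈ S then 1 else 0 := by
  classical
  simp [indicatorVec, Finsupp.finsetSum_apply, Finsupp.single_apply]

theorem degree_indicatorVec {n : ℕ} (S : Finset (Fin n)) : (indicatorVec S).degree = S.card := by
  simp [indicatorVec, map_sum]

/-- The sets `S` for which `x^a / x^S` is a monomial with exponent in `N`. -/
def strand {n : ℕ} (N : Set (Fin n →₀ ℕ)) (a : Fin n →₀ ℕ) : Set (Finset (Fin n)) :=
  {S | ∃ b ∈ N, b + indicatorVec S = a}

/-- Exactness of the Koszul complex of `R / J` in homological degree `i` and degree `j`, with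
representatives in `R`. -/
def KoszulExact {K : Type*} [Field K] {n : ℕ} (J : Ideal (MvPolynomial (Fin n) K)) (i j : ℕ) :
    Prop :=
  ∀ q : Finset (Fin n) → MvPolynomial (Fin n) K,
    (∀ S b, coeff b (q S) ≠ 0 → S.card = i ∧ b.degree + i = j) →
    (∀ T, koszul (K := K) q T ∈ J) →
    ∃ y : Finset (Fin n) → MvPolynomial (Fin n) K,
      (∀ S b, coeff b (y S) ≠ 0 → S.card = i + 1 ∧ b.degree + (i + 1) = j) ∧
      ∀ S, q S - koszul (K := K) y S ∈ J

/-- The Koszul differential preserves the multidegree `b + indicatorVec S` of a term `x^b e_S`, so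
the complex of `R/J` is a direct sum of strands, and a preimage can be chosen in each multidegree
separately. -/
theorem koszulExact_of_strand {K : Type*} [Field K] {n : ℕ}
    {J : Ideal (MvPolynomial (Fin n) K)} {N : Set (Fin n →₀ ℕ)}
    (hJ : ∀ p, p ∈ J ↔ ∀ b ∈ N, coeff b p = 0) {i j : ℕ}
    (h : ∀ a : Fin n →₀ ℕ, a.degree = j → ExactAt K (strand N a) i) : KoszulExact J i j := by
  classical
  intro q hq hcyc
  -- The exponents outside a monomial ideal are closed under division, because `J` absorbs
  -- multiplication by `X v`.
  have hlow : ∀ b v, b + Finsupp.single v 1 ∈ N → b ∈ N := by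
    intro b v hb
    by_contra hbN
    have h1 : monomial b (1 : K) ∈ J := by
      rw [hJ]; intro c hc
      rw [coeff_monomial, if_neg]
      rintro rfl; exact hbN hc
    have h2 := (hJ _).1 (J.mul_mem_right (X v) h1) _ hb
    rw [coeff_mul_X] at h2
    simp at h2
  -- membership of an enlarged set in a strand
  have hstr : ∀ (b : Fin n →₀ ℕ) (T : Finset (Fin n)) (v : Fin n), b ∈ N → v ∉ T →
      (insert v T ∈ strand N (b + indicatorVec T) ↔ v ∈ b.support) := by
    intro b T v hb hv
    constructor
    · rintro ⟨c, _, hc⟩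
      rw [indicatorVec_insert hv, ← add_assoc] at hc
      have := congrArg (fun f => f v) (add_right_cancel hc)
      simp at this
      simp
      omega
    · intro hvb
      have hle : Finsupp.single v 1 ≤ b := by
        rw [Finsupp.single_le_iff]; simp at hvb; omega
      refine ⟨b - Finsupp.single v 1, hlow _ v ?_, ?_⟩
      · rwa [tsub_add_cancel_of_le hle]
      · rw [indicatorVec_insert hv, ← add_assoc, tsub_add_cancel_of_le hle]
  have hex : ∀ a : Fin n →₀ ℕ, ∃ ψ : Finset (Fin n) → K, a.degree = j →
      (∀ S, ψ S ≠ 0 → S ∈ strand N a ∧ S.card = i + 1) ∧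
      ∀ S ∈ strand N a, ∑ v ∈ Sᶜ, insertSign v S • ψ (insert v S) =
        coeff (a - indicatorVec S) (q S) := by
    intro a
    by_cases ha : a.degree = j
    · have hsupp : ∀ S, (if S ∈ strand N a then coeff (a - indicatorVec S) (q S) else 0) ≠ 0 →
          S ∈ strand N a ∧ S.card = i := by
        intro S hS
        by_cases hs : S ∈ strand N a
        · rw [if_pos hs] at hS
          exact ⟨hs, (hq _ _ hS).1⟩
        · simp [hs] at hS
      have hφ : ∀ T ∈ strand N a, ∑ v ∈ Tᶜ, insertSign v T • (if insert v T ∈ strand N a then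
          coeff (a - indicatorVec (insert v T)) (q (insert v T)) else 0) = 0 := by
        rintro T ⟨b, hb, rfl⟩
        have h0 := (hJ _).1 (hcyc T) b hb
        rw [coeff_koszul] at h0
        refine Eq.trans ?_ h0
        refine Finset.sum_congr rfl fun v hv => ?_
        have hv' : v ∉ T := by simpa using hv
        congr 1
        rw [if_congr (hstr b T v hb hv') rfl rfl]
        by_cases hvb : v ∈ b.support
        · rw [if_pos hvb, if_pos hvb, indicatorVec_insert hv', tsub_add_eq_tsub_tsub_swap,
            add_tsub_cancel_right]
        · rw [if_neg hvb, if_neg hvb]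
      obtain ⟨ψ, h1, h2⟩ := h a ha _ hsupp hφ
      refine ⟨ψ, fun _ => ⟨h1, fun S hS => ?_⟩⟩
      rw [h2 S hS, if_pos hS]
    · exact ⟨0, fun h => absurd h ha⟩
  choose ψ hψ using hex
  -- The preimages of the strands are glued: the coefficient of `x^b` at `S` is taken from the
  -- multidegree `b + indicatorVec S`. The sum runs over all exponents of degree `j - S.card`; the
  -- test on the degree discards the `S` with more than `j` elements, where this subtraction
  -- truncates.
  set y : Finset (Fin n) → MvPolynomial (Fin n) K := fun S =>
    ∑ b ∈ Finset.univ.finsuppAntidiag (j - S.card),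
      if (b + indicatorVec S).degree = j then monomial b (ψ (b + indicatorVec S) S) else 0 with hy
  have hcoeff : ∀ S b, coeff b (y S) =
      if (b + indicatorVec S).degree = j then ψ (b + indicatorVec S) S else 0 := by
    intro S b
    rw [hy]
    simp only [coeff_sum]
    by_cases hb : (b + indicatorVec S).degree = j
    · rw [if_pos hb, Finset.sum_eq_single b]
      · rw [if_pos hb, coeff_monomial, if_pos rfl]
      · intro c _ hc
        split_ifs
        · rw [coeff_monomial, if_neg hc]
        · simp
      · intro hc
        exfalso; apply hc
        rw [Finset.mem_finsuppAntidiag]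
        refine ⟨?_, Finset.subset_univ _⟩
        rw [map_add, degree_indicatorVec, Finsupp.degree_eq_sum] at hb
        change ∑ x, b x = _
        omega
    · rw [if_neg hb]
      refine Finset.sum_eq_zero fun c _ => ?_
      by_cases hc : c = b
      · subst hc; rw [if_neg hb, coeff_zero]
      · split_ifs
        · rw [coeff_monomial, if_neg hc]
        · simp
  have hysupp : ∀ S b, coeff b (y S) ≠ 0 → S.card = i + 1 ∧ b.degree + (i + 1) = j := by
    intro S b hb
    rw [hcoeff] at hb
    split_ifs at hb with hd
    · have h1 := ((hψ _ hd).1 S hb).2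
      rw [map_add, degree_indicatorVec] at hd
      exact ⟨h1, by omega⟩
    · exact absurd rfl hb
  refine ⟨y, hysupp, fun S => ?_⟩
  rw [hJ]
  intro b hb
  rw [coeff_sub, sub_eq_zero, coeff_koszul]
  by_cases hd : (b + indicatorVec S).degree = j
  · have h1 := (hψ _ hd).2 S ⟨b, hb, rfl⟩
    rw [add_tsub_cancel_right] at h1
    rw [← h1]
    refine Finset.sum_congr rfl fun v hv => ?_
    have hv' : v ∉ S := by simpa using hv
    congr 1
    by_cases hvb : v ∈ b.support
    · have hle : Finsupp.single v 1 ≤ b := by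
        rw [Finsupp.single_le_iff]; simp at hvb; omega
      have he : b - Finsupp.single v 1 + indicatorVec (insert v S) = b + indicatorVec S := by
        rw [indicatorVec_insert hv', ← add_assoc, tsub_add_cancel_of_le hle]
      rw [if_pos hvb, hcoeff, he, if_pos hd]
    · rw [if_neg hvb]
      by_contra hne
      exact hvb ((hstr b S v hb hv').1 ((hψ _ hd).1 _ hne).1)
  · have h1 : coeff b (q S) = 0 := by
      by_contra hne
      obtain ⟨h2, h3⟩ := hq S b hne
      apply hd; rw [map_add, degree_indicatorVec]; omega
    rw [h1]
    symm
    refine Finset.sum_eq_zero fun v hv => ?_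
    have hv' : v ∉ S := by simpa using hv
    refine (congrArg _ ?_).trans (smul_zero _)
    by_contra hne
    split_ifs at hne with hvb
    · obtain ⟨h2, h3⟩ := hysupp _ _ hne
      rw [Finset.card_insert_of_notMem hv'] at h2
      have hle : Finsupp.single v 1 ≤ b := by
        rw [Finsupp.single_le_iff]; simp at hvb; omega
      apply hd
      rw [← tsub_add_cancel_of_le hle, map_add, map_add, degree_indicatorVec, Finsupp.degree_single]
      omega
    · exact hne rfl

/-- In a multidegree `a ≠ 0` any `v` with `a v ≠ 0` may be moved between the monomial and the
exterior factor, so the strand is contractible. Only the multidegree `0`, at `(0,0)`, has homology.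
-/
theorem koszulExact_bot {K : Type*} [Field K] {n : ℕ} {i j : ℕ} (hij : ¬(i = 0 ∧ j = 0)) :
    KoszulExact (⊥ : Ideal (MvPolynomial (Fin n) K)) i j := by
  classical
  refine koszulExact_of_strand (N := Set.univ) (fun p => ?_) fun a ha => ?_
  · rw [Ideal.mem_bot, MvPolynomial.ext_iff]; simp
  by_cases h0 : a = 0
  · subst h0
    refine exactAt_of_card_ne ?_
    rintro S ⟨b, _, hb⟩ hi
    have := congrArg Finsupp.degree hb
    simp only [map_add, degree_indicatorVec, map_zero] at this ha
    omega
  · obtain ⟨v, hv⟩ := Finsupp.ne_iff.1 h0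
    refine exactAt_of_toggle v ?_ ?_ i
    · rintro S ⟨b, _, rfl⟩
      by_cases hvS : v ∈ S
      · rw [Finset.insert_eq_of_mem hvS]; exact ⟨b, trivial, rfl⟩
      · have hle : Finsupp.single v 1 ≤ b := by
          rw [Finsupp.single_le_iff]
          simp [indicatorVec_apply, hvS] at hv; omega
        refine ⟨b - Finsupp.single v 1, trivial, ?_⟩
        rw [indicatorVec_insert hvS, ← add_assoc, tsub_add_cancel_of_le hle]
    · rintro S ⟨b, _, rfl⟩
      by_cases hvS : v ∈ S
      · refine ⟨b + Finsupp.single v 1, trivial, ?_⟩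
        rw [add_assoc, ← indicatorVec_insert (Finset.notMem_erase v S), Finset.insert_erase hvS]
      · rw [Finset.erase_eq_of_notMem hvS]; exact ⟨b, trivial, rfl⟩

/-! ### Homogeneous vectors and maps of graded free modules -/

section homogVec
variable {K : Type*} [Field K] {n : ℕ}

/-- `z` is an element of degree `t` of the graded free module `⨁_a R(-deg a)`. -/
def IsHomogVec {r : ℕ} (deg : Fin r → ℕ) (t : ℕ) (z : Fin r → MvPolynomial (Fin n) K) : Prop :=
  ∀ a s, coeff s (z a) ≠ 0 → s.degree + deg a = t

/-- `d` preserves the degrees of the graded free modules. -/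
def IsHomogMap {r r' : ℕ} (deg' : Fin r' → ℕ) (deg : Fin r → ℕ)
    (d : (Fin r' → MvPolynomial (Fin n) K) →ₗ[MvPolynomial (Fin n) K]
      (Fin r → MvPolynomial (Fin n) K)) : Prop :=
  ∀ a b s, coeff s (d (Pi.single b 1) a) ≠ 0 → s.degree + deg a = deg' b

theorem map_eq_sum_single {R M : Type*} [CommSemiring R] [AddCommMonoid M] [Module R M] {r : ℕ}
    (f : (Fin r → R) →ₗ[R] M) (z : Fin r → R) : f z = ∑ b, z b • f (Pi.single b 1) := by
  conv_lhs => rw [← Finset.univ_sum_single z, map_sum]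
  refine Finset.sum_congr rfl fun b _ => ?_
  rw [← map_smul, ← Pi.single_smul, smul_eq_mul, mul_one]

theorem exists_coeff_of_coeff_mul_ne_zero {p q : MvPolynomial (Fin n) K} {s : Fin n →₀ ℕ}
    (h : coeff s (p * q) ≠ 0) : ∃ u v, u + v = s ∧ coeff u p ≠ 0 ∧ coeff v q ≠ 0 := by
  rw [coeff_mul] at h
  obtain ⟨⟨u, v⟩, huv, hne⟩ := Finset.exists_ne_zero_of_sum_ne_zero h
  exact ⟨u, v, Finset.HasAntidiagonal.mem_antidiagonal.1 huv, left_ne_zero_of_mul hne, right_ne_zero_of_mul hne⟩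

theorem IsHomogMap.map {r r' : ℕ} {deg' : Fin r' → ℕ} {deg : Fin r → ℕ}
    {d : (Fin r' → MvPolynomial (Fin n) K) →ₗ[MvPolynomial (Fin n) K]
      (Fin r → MvPolynomial (Fin n) K)} (hd : IsHomogMap deg' deg d) {t : ℕ}
    {z : Fin r' → MvPolynomial (Fin n) K} (hz : IsHomogVec deg' t z) :
    IsHomogVec deg t (d z) := by
  intro a s hs
  rw [map_eq_sum_single, Finset.sum_apply, coeff_sum] at hs
  obtain ⟨b, _, hb⟩ := Finset.exists_ne_zero_of_sum_ne_zero hs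
  rw [Pi.smul_apply, smul_eq_mul] at hb
  obtain ⟨u, v, rfl, hu, hv⟩ := exists_coeff_of_coeff_mul_ne_zero hb
  have h1 := hz b u hu
  have h2 := hd a b v hv
  rw [map_add]; omega

theorem koszul_pi_apply {r : ℕ} (ω : Finset (Fin n) → Fin r → MvPolynomial (Fin n) K)
    (T : Finset (Fin n)) (a : Fin r) :
    koszul (K := K) ω T a = koszul (K := K) (fun S => ω S a) T := by
  simp only [koszul, Finset.sum_apply, Pi.smul_apply]

theorem constantCoeff_map_eq_zero {r r' : ℕ}
    {d : (Fin r' → MvPolynomial (Fin n) K) →ₗ[MvPolynomial (Fin n) K]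
      (Fin r → MvPolynomial (Fin n) K)}
    (hd : ∀ a b, constantCoeff (d (Pi.single b 1) a) = 0)
    (z : Fin r' → MvPolynomial (Fin n) K) (a : Fin r) : constantCoeff (d z a) = 0 := by
  rw [map_eq_sum_single, Finset.sum_apply, map_sum]
  refine Finset.sum_eq_zero fun b _ => ?_
  rw [Pi.smul_apply, smul_eq_mul, map_mul, hd, mul_zero]

end homogVec

/-! ### Vanishing of Betti numbers by dimension shifting -/

namespace MinimalFreeResolution
variable {K : Type*} [Field K] {n : ℕ} {I : Ideal (MvPolynomial (Fin n) K)}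
  (F : MinimalFreeResolution I)

theorem isHomogMap (i : ℕ) : IsHomogMap (F.deg (i + 1)) (F.deg i) (F.diff i) :=
  F.diff_homogeneous i

/-- Exactness of the Koszul complex of the cokernel of `F_{k+1} → F_k` in homological degree `p`
and degree `j`. -/
def SyzygyExact (p k j : ℕ) : Prop :=
  ∀ z : Finset (Fin n) → Fin (F.rank k) → MvPolynomial (Fin n) K,
    (∀ S a s, coeff s (z S a) ≠ 0 → S.card = p ∧ s.degree + F.deg k a + p = j) →
    (∀ T, ∃ w, F.diff k w = koszul (K := K) z T) →
    ∃ (y : Finset (Fin n) → Fin (F.rank k) → MvPolynomial (Fin n) K)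
      (w : Finset (Fin n) → Fin (F.rank (k + 1)) → MvPolynomial (Fin n) K),
      ∀ S, z S = koszul (K := K) y S + F.diff k (w S)

/-- The cokernel of `F_1 → F_0` is `R/I`. Lifting the values of the augmentation to forms `g a`
carries cycles over to representatives in `R`, and surjectivity carries the boundary back. -/
theorem syzygyExact_zero {p j : ℕ} (h : KoszulExact I p j) : F.SyzygyExact p 0 j := by
  intro z hz hcyc
  have hg : ∀ a, ∃ g : MvPolynomial (Fin n) K, g ∈ homogeneousSubmodule (Fin n) K (F.deg 0 a) ∧
      Ideal.Quotient.mk I g = F.aug (Pi.single a 1) := fun a => F.aug_homogeneous a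
  choose g hg1 hg2 using hg
  set q : Finset (Fin n) → MvPolynomial (Fin n) K := fun S => ∑ a, z S a * g a with hq
  have hmk : ∀ S, Submodule.mkQ I (q S) = F.aug (z S) := by
    intro S
    rw [map_eq_sum_single, hq, map_sum]
    refine Finset.sum_congr rfl fun a _ => ?_
    rw [← hg2]
    rfl
  have hq1 : ∀ S b, coeff b (q S) ≠ 0 → S.card = p ∧ b.degree + p = j := by
    intro S b hb
    rw [hq] at hb
    simp only [coeff_sum] at hb
    obtain ⟨a, _, ha⟩ := Finset.exists_ne_zero_of_sum_ne_zero hb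
    obtain ⟨u, v, rfl, hu, hv⟩ := exists_coeff_of_coeff_mul_ne_zero ha
    obtain ⟨h1, h2⟩ := hz S a u hu
    have h3 : v.degree = F.deg 0 a := by
      have := hg1 a hv
      rwa [Finsupp.degree_eq_weight_one]
    refine ⟨h1, ?_⟩
    rw [map_add]; omega
  have hq2 : ∀ T, koszul (K := K) q T ∈ I := by
    intro T
    obtain ⟨w, hw⟩ := hcyc T
    have h0 : F.aug (F.diff 0 w) = 0 := by
      rw [← LinearMap.mem_ker, ← F.exact_zero]; exact ⟨w, rfl⟩
    rw [hw, map_koszul] at h0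
    simp only [← hmk] at h0
    rw [← map_koszul] at h0
    exact (Submodule.Quotient.mk_eq_zero I).1 h0
  obtain ⟨y, _, hy⟩ := h q hq1 hq2
  choose y' hy' using fun S => F.aug_surjective (Submodule.mkQ I (y S))
  have hker : ∀ S, ∃ w, F.diff 0 w = z S - koszul (K := K) y' S := by
    intro S
    have : z S - koszul (K := K) y' S ∈ LinearMap.range (F.diff 0) := by
      rw [F.exact_zero, LinearMap.mem_ker, map_sub, map_koszul, ← hmk]
      simp only [hy']
      rw [← map_koszul, ← map_sub]
      exact (Submodule.Quotient.mk_eq_zero I).2 (hy S)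
    exact this
  choose w hw using hker
  refine ⟨y', w, fun S => ?_⟩
  rw [hw]; abel

/-- The connecting map of the long exact sequence for a syzygy module, written out: a cycle `z`
modulo the image of `F_{k+2}` has a differential that is a Koszul cycle in the free module `F_k`,
hence a boundary of some `y`. This `y` is a cycle of one exterior degree more, modulo the image of
`F_{k+1}`; resolving it yields a correction of `z` killed by the differential. -/
theorem SyzygyExact.succ {p k j : ℕ} (h : F.SyzygyExact (p + 1) k j) :
    F.SyzygyExact p (k + 1) j := by
  classical
  intro z hz hcyc
  have hdd : ∀ i w, F.diff i (F.diff (i + 1) w) = 0 := fun i w => by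
    rw [← LinearMap.mem_ker, ← F.exact_succ]; exact ⟨w, rfl⟩
  have hdz : ∀ S a s, coeff s (F.diff k (z S) a) ≠ 0 →
      S.card = p ∧ s.degree + F.deg k a + p = j := by
    intro S a s hs
    by_cases hS : S.card = p ∧ p ≤ j
    · have h1 : IsHomogVec (F.deg (k + 1)) (j - p) (z S) := by
        intro b u hu
        have := (hz S b u hu).2
        omega
      have := (F.isHomogMap k).map h1 a s hs
      exact ⟨hS.1, by omega⟩
    · exfalso
      have : z S = 0 := by
        funext b
        ext u
        by_contra hne
        have := hz S b u hne
        omega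
      rw [this, map_zero] at hs
      simp at hs
  have hcompz : ∀ a, ∃ y : Finset (Fin n) → MvPolynomial (Fin n) K,
      (∀ S s, coeff s (y S) ≠ 0 → S.card = p + 1 ∧ s.degree + F.deg k a + (p + 1) = j) ∧
      ∀ S, koszul (K := K) y S = F.diff k (z S) a := by
    intro a
    -- The excluded case is bidegree `(0,0)` after the shift by `F.deg k a`, where the Koszul
    -- complex of `R` is not exact, or a negative degree. Any entry there would be a constant, which
    -- minimality forbids.
    by_cases hc : F.deg k a ≤ j ∧ ¬(p = 0 ∧ j = F.deg k a)
    · obtain ⟨y, h1, h2⟩ := koszulExact_bot (K := K) (n := n) (i := p) (j := j - F.deg k a)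
        (by omega) (fun S => F.diff k (z S) a)
        (fun S b hb => by have := hdz S a b hb; omega)
        (fun T => by
          obtain ⟨w, hw⟩ := hcyc T
          have h3 := hdd k w
          rw [hw, map_koszul] at h3
          have h4 := congrFun h3 a
          rw [Ideal.mem_bot]
          rw [koszul_pi_apply] at h4
          exact h4)
      refine ⟨y, fun S s hs => ?_, fun S => ?_⟩
      · have := h1 S s hs; omega
      · have := h2 S
        rw [Ideal.mem_bot, sub_eq_zero] at this
        exact this.symm
    · refine ⟨0, by simp, fun S => ?_⟩
      have h0 : F.diff k (z S) a = 0 := by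
        ext s
        by_contra hne
        obtain ⟨h1, h2⟩ := hdz S a s hne
        have h3 : s.degree = 0 := by omega
        rw [Finsupp.degree_eq_zero_iff] at h3
        subst h3
        exact hne (constantCoeff_map_eq_zero (F.minimal k) (z S) a)
      rw [h0]
      simp [koszul]
  choose y hy1 hy2 using hcompz
  have hκ : ∀ S, koszul (K := K) (fun S a => y a S) S = F.diff k (z S) := by
    intro S
    funext a
    rw [← hy2, koszul_pi_apply]
  obtain ⟨y', w, hw⟩ := h (fun S a => y a S) (fun S a s hs => hy1 a S s hs)
    (fun T => ⟨z T, (hκ T).symm⟩)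
  have hw' : (fun S a => y a S) = koszul (K := K) y' + fun S => F.diff k (w S) := by
    funext S; exact hw S
  have hker : ∀ S, ∃ w', F.diff (k + 1) w' = z S - koszul (K := K) w S := by
    intro S
    have : z S - koszul (K := K) w S ∈ LinearMap.range (F.diff (k + 1)) := by
      rw [F.exact_succ, LinearMap.mem_ker, map_sub, map_koszul, ← hκ, hw', koszul_add,
        koszul_koszul, zero_add, sub_self]
    exact this
  choose w' hw'' using hker
  refine ⟨w, w', fun S => ?_⟩
  rw [hw'']; abel

/-- After `i` shifts the assumption says that the cokernel of `F_{i+1} → F_i`, modulo the variables,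
vanishes in degree `j`. -/
theorem betti_eq_zero {i j : ℕ} (h : KoszulExact I i j) : F.betti i j = 0 := by
  classical
  have hstep : ∀ k p, p + k = i → F.SyzygyExact p k j := by
    intro k
    induction k with
    | zero => intro p hp; obtain rfl : p = i := by omega
              exact F.syzygyExact_zero h
    | succ k ih => intro p hp; exact SyzygyExact.succ F (ih (p + 1) (by omega))
  have h0 := hstep i 0 (by omega)
  rw [betti, Finset.card_eq_zero, Finset.filter_eq_empty_iff]
  intro a _ ha
  -- A basis element of degree `j` as a Koszul cycle of exterior degree `0`. It would be a Koszul
  -- boundary plus an element of the image of `F_{i+1}`; both have zero constant terms, but the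
  -- basis element has the entry `1`.
  set z : Finset (Fin n) → Fin (F.rank i) → MvPolynomial (Fin n) K :=
    fun S => if S = ∅ then Pi.single a 1 else 0 with hz
  have hz1 : ∀ S b s, coeff s (z S b) ≠ 0 → S.card = 0 ∧ s.degree + F.deg i b + 0 = j := by
    intro S b s hs
    rw [hz] at hs
    beta_reduce at hs
    by_cases hS : S = ∅
    · subst hS
      rw [if_pos rfl] at hs
      by_cases hb : b = a
      · subst hb
        rw [Pi.single_eq_same, coeff_one] at hs
        have h1 : s = 0 := by
          by_contra hne; exact hs (if_neg (Ne.symm hne))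
        subst h1
        simp [ha]
      · rw [Pi.single_eq_of_ne hb] at hs; simp at hs
    · rw [if_neg hS] at hs; simp at hs
  have hz2 : ∀ T, ∃ w, F.diff i w = koszul (K := K) z T := by
    intro T
    refine ⟨0, ?_⟩
    rw [map_zero, koszul]
    symm
    refine Finset.sum_eq_zero fun v _ => ?_
    rw [hz]
    beta_reduce
    rw [if_neg (Finset.insert_ne_empty _ _), smul_zero, smul_zero]
  obtain ⟨y, w, hyw⟩ := h0 z hz1 hz2
  have h1 := congrArg constantCoeff (congrFun (hyw ∅) a)
  rw [show z ∅ = Pi.single a 1 from if_pos rfl, Pi.add_apply, map_add, constantCoeff_map_eq_zero (F.minimal i), koszul,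
  Finset.sum_apply, map_sum, Finset.sum_eq_zero] at h1
  · simp at h1
  · intro v _
    rw [Pi.smul_apply, map_zsmul]
    simp

end MinimalFreeResolution

theorem gradedBetti_eq_zero {K : Type*} [Field K] {n : ℕ} {I : Ideal (MvPolynomial (Fin n) K)}
    {i j : ℕ} (h : KoszulExact I i j) : gradedBetti I i j = 0 := by
  unfold gradedBetti
  split_ifs with hF
  · exact hF.some.betti_eq_zero h
  · rfl

/-! ### Existence of minimal graded free resolutions -/

section homogPart
variable {K : Type*} [Field K] {n r : ℕ}

/-- The component of degree `t` of an element of `⨁_a R(-deg a)`. -/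
def homogPart (deg : Fin r → ℕ) (t : ℕ) (z : Fin r → MvPolynomial (Fin n) K) :
    Fin r → MvPolynomial (Fin n) K :=
  fun a => if deg a ≤ t then homogeneousComponent (t - deg a) (z a) else 0

theorem coeff_homogPart (deg : Fin r → ℕ) (t : ℕ) (z : Fin r → MvPolynomial (Fin n) K)
    (a : Fin r) (s : Fin n →₀ ℕ) :
    coeff s (homogPart deg t z a) = if s.degree + deg a = t then coeff s (z a) else 0 := by
  unfold homogPart
  by_cases h : deg a ≤ t
  · rw [if_pos h, coeff_homogeneousComponent]
    exact if_congr (by omega) rfl rfl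
  · rw [if_neg h, if_neg (by omega), coeff_zero]

theorem isHomogVec_homogPart (deg : Fin r → ℕ) (t : ℕ) (z : Fin r → MvPolynomial (Fin n) K) :
    IsHomogVec deg t (homogPart deg t z) := by
  intro a s hs
  rw [coeff_homogPart] at hs
  by_contra h
  exact hs (if_neg h)

theorem homogPart_of_isHomogVec {deg : Fin r → ℕ} {t t' : ℕ} {z : Fin r → MvPolynomial (Fin n) K}
    (hz : IsHomogVec deg t' z) : homogPart deg t z = if t = t' then z else 0 := by
  funext a
  ext s
  rw [coeff_homogPart]
  by_cases h : coeff s (z a) = 0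
  · split_ifs <;> simp [h]
  · have := hz a s h
    by_cases ht : t = t'
    · rw [if_pos (by omega), if_pos ht]
    · rw [if_neg (by omega), if_neg ht]; simp

theorem homogPart_sum {ι : Type*} (deg : Fin r → ℕ) (t : ℕ) (T : Finset ι)
    (z : ι → Fin r → MvPolynomial (Fin n) K) :
    homogPart deg t (∑ i ∈ T, z i) = ∑ i ∈ T, homogPart deg t (z i) := by
  funext a
  ext s
  rw [coeff_homogPart, Finset.sum_apply, Finset.sum_apply, coeff_sum, coeff_sum]
  simp only [coeff_homogPart]
  split_ifs
  · rfl
  · simp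

theorem exists_sum_homogPart (deg : Fin r → ℕ) (z : Fin r → MvPolynomial (Fin n) K) :
    ∃ T : Finset ℕ, z = ∑ t ∈ T, homogPart deg t z := by
  classical
  refine ⟨Finset.univ.biUnion fun a => (z a).support.image fun s => s.degree + deg a, ?_⟩
  funext a
  ext s
  rw [Finset.sum_apply, coeff_sum]
  simp only [coeff_homogPart]
  by_cases hs : coeff s (z a) = 0
  · simp [hs]
  · rw [Finset.sum_ite_eq, if_pos]
    simp only [Finset.mem_biUnion, Finset.mem_univ, true_and, Finset.mem_image, mem_support_iff]
    exact ⟨a, s, hs, rfl⟩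

theorem IsHomogMap.map_homogPart {r' : ℕ} {deg' : Fin r' → ℕ} {deg : Fin r → ℕ}
    {d : (Fin r' → MvPolynomial (Fin n) K) →ₗ[MvPolynomial (Fin n) K]
      (Fin r → MvPolynomial (Fin n) K)} (hd : IsHomogMap deg' deg d) (t : ℕ)
    (z : Fin r' → MvPolynomial (Fin n) K) :
    d (homogPart deg' t z) = homogPart deg t (d z) := by
  obtain ⟨T, hT⟩ := exists_sum_homogPart deg' z
  conv_rhs => rw [hT, map_sum, homogPart_sum]
  conv_lhs => rw [hT, homogPart_sum, map_sum]
  refine Finset.sum_congr rfl fun u _ => ?_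
  rw [homogPart_of_isHomogVec (isHomogVec_homogPart deg' u z),
    homogPart_of_isHomogVec (hd.map (isHomogVec_homogPart deg' u z))]
  split_ifs <;> simp

theorem exists_homog_generators (deg : Fin r → ℕ)
    (Z : Submodule (MvPolynomial (Fin n) K) (Fin r → MvPolynomial (Fin n) K))
    (hZ : ∀ z ∈ Z, ∀ t, homogPart deg t z ∈ Z) :
    ∃ (m : ℕ) (g : Fin m → Fin r → MvPolynomial (Fin n) K),
      (∀ b, ∃ t, IsHomogVec deg t (g b)) ∧
      Submodule.span (MvPolynomial (Fin n) K) (Set.range g) = Z := by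
  classical
  obtain ⟨S, hS⟩ := IsNoetherian.noetherian Z
  choose T hT using exists_sum_homogPart (K := K) (n := n) deg
  set S' : Finset (Fin r → MvPolynomial (Fin n) K) :=
    S.biUnion fun z => (T z).image fun t => homogPart deg t z with hS'
  refine ⟨S'.card, fun b => (S'.equivFin.symm b : _), fun b => ?_, ?_⟩
  · have h := (S'.equivFin.symm b).2
    simp only [hS', Finset.mem_biUnion, Finset.mem_image] at h
    obtain ⟨z, _, t, _, h⟩ := h
    refine ⟨t, ?_⟩
    beta_reduce
    rw [← h]
    exact isHomogVec_homogPart deg t z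
  · have hrange : Set.range (fun b => ((S'.equivFin.symm b : S') :
        Fin r → MvPolynomial (Fin n) K)) = (S' : Set (Fin r → MvPolynomial (Fin n) K)) := by
      ext x
      constructor
      · rintro ⟨b, rfl⟩; exact (S'.equivFin.symm b).2
      · intro hx; exact ⟨S'.equivFin ⟨x, hx⟩, by simp⟩
    rw [hrange]
    refine le_antisymm (Submodule.span_le.2 ?_) ?_
    · intro x hx
      simp only [hS', Finset.coe_biUnion, Set.mem_iUnion, Finset.coe_image, Set.mem_image] at hx
      obtain ⟨z, hz, t, _, rfl⟩ := hx
      refine hZ z ?_ t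
      rw [← hS]; exact Submodule.subset_span hz
    · rw [← hS, Submodule.span_le]
      intro z hz
      rw [SetLike.mem_coe, hT z]
      refine Submodule.sum_mem _ fun t ht => Submodule.subset_span ?_
      simp only [hS', Finset.coe_biUnion, Set.mem_iUnion, Finset.coe_image, Set.mem_image]
      exact ⟨z, hz, t, ht, rfl⟩

/-- Homogeneous generators as few as possible: a syzygy with a nonzero constant term in one entry
would make that generator redundant. -/
theorem exists_minimal_cover (deg : Fin r → ℕ)
    (Z : Submodule (MvPolynomial (Fin n) K) (Fin r → MvPolynomial (Fin n) K))
    (hZ : ∀ z ∈ Z, ∀ t, homogPart deg t z ∈ Z) :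
    ∃ (m : ℕ) (deg' : Fin m → ℕ) (d : (Fin m → MvPolynomial (Fin n) K)
      →ₗ[MvPolynomial (Fin n) K] (Fin r → MvPolynomial (Fin n) K)),
      IsHomogMap deg' deg d ∧ LinearMap.range d = Z ∧
      ∀ z, d z = 0 → ∀ b, constantCoeff (z b) = 0 := by
  classical
  have hex := exists_homog_generators deg Z hZ
  obtain ⟨g, hg, hspan⟩ := Nat.find_spec hex
  have hmin := fun {k} => Nat.find_min (m := k) hex
  generalize Nat.find hex = m at g hg hspan hmin
  choose deg' hdeg' using hg
  have hd : IsHomogMap deg' deg (Fintype.linearCombination (MvPolynomial (Fin n) K) g) := by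
    intro a b s hs
    rw [Fintype.linearCombination_apply_single, one_smul] at hs
    exact hdeg' b a s hs
  refine ⟨m, deg', Fintype.linearCombination _ g, hd, ?_, ?_⟩
  · rw [Fintype.range_linearCombination, hspan]
  · intro z hz b
    by_contra hc
    cases m with
    | zero => exact b.elim0
    | succ m =>
      apply hmin (Nat.lt_succ_self m)
      refine ⟨fun c => g (b.succAbove c), fun c => ⟨_, hdeg' _⟩, ?_⟩
      rw [← hspan]
      refine le_antisymm (Submodule.span_mono ?_) (Submodule.span_le.2 ?_)
      · rintro _ ⟨c, rfl⟩; exact ⟨_, rfl⟩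
      · rintro _ ⟨c, rfl⟩
        by_cases hcb : c = b
        · subst hcb
          -- In degree `deg' c` the coefficient of `g c` reduces to its constant term, a unit of
          -- `K`, so the relation can be solved for `g c`.
          have h0 := hd.map_homogPart (deg' c) z
          rw [hz, Fintype.linearCombination_apply, Fin.sum_univ_succAbove _ c] at h0
          have hzero : homogPart deg (deg' c) (0 : Fin r → MvPolynomial (Fin n) K) = 0 := by
            funext a; simp [homogPart]
          have hC : homogPart deg' (deg' c) z c = C (constantCoeff (z c)) := by
            ext s
            rw [coeff_homogPart, coeff_C]
            by_cases hs : 0 = s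
            · subst hs; simp [constantCoeff_eq]
            · rw [if_neg hs, if_neg]
              intro h
              have : s.degree = 0 := by omega
              rw [Finsupp.degree_eq_zero_iff] at this
              exact hs this.symm
          rw [hzero, hC] at h0
          have hgc : g c = -((C (constantCoeff (z c))⁻¹ : MvPolynomial (Fin n) K) • ∑ i,
              homogPart deg' (deg' c) z (c.succAbove i) • g (c.succAbove i)) := by
            rw [eq_neg_of_add_eq_zero_right h0, smul_neg, neg_neg, smul_smul, ← C_mul,
              inv_mul_cancel₀ hc, C_1, one_smul]
          rw [SetLike.mem_coe, hgc]
          refine Submodule.neg_mem _ (Submodule.smul_mem _ _ (Submodule.sum_mem _ fun i _ =>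
            Submodule.smul_mem _ _ (Submodule.subset_span ⟨i, rfl⟩)))
        · obtain ⟨i, rfl⟩ := Fin.exists_succAbove_eq hcb
          exact Submodule.subset_span ⟨i, rfl⟩

end homogPart

/-- A graded submodule of `(x_1, …, x_n) F` for a graded free module `F`. -/
structure MinimalSyzygy (K : Type*) [Field K] (n : ℕ) where
  /-- the rank of `F` -/
  rank : ℕ
  /-- the degrees of the basis elements of `F` -/
  deg : Fin rank → ℕ
  /-- the submodule -/
  carrier : Submodule (MvPolynomial (Fin n) K) (Fin rank → MvPolynomial (Fin n) K)
  homogPart_mem : ∀ z ∈ carrier, ∀ t, homogPart deg t z ∈ carrier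
  constantCoeff_eq_zero : ∀ z ∈ carrier, ∀ a, constantCoeff (z a) = 0

theorem MinimalSyzygy.exists_next {K : Type*} [Field K] {n : ℕ} (Z : MinimalSyzygy K n) :
    ∃ (Z' : MinimalSyzygy K n) (d : (Fin Z'.rank → MvPolynomial (Fin n) K)
      →ₗ[MvPolynomial (Fin n) K] (Fin Z.rank → MvPolynomial (Fin n) K)),
      IsHomogMap Z'.deg Z.deg d ∧ LinearMap.range d = Z.carrier ∧
        LinearMap.ker d = Z'.carrier := by
  obtain ⟨m, deg', d, h1, h2, h3⟩ := exists_minimal_cover Z.deg Z.carrier Z.homogPart_mem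
  refine ⟨⟨m, deg', LinearMap.ker d, ?_, h3⟩, d, h1, h2, rfl⟩
  intro z hz t
  rw [LinearMap.mem_ker] at hz ⊢
  rw [h1.map_homogPart, hz]
  funext a; simp [homogPart]

/-- The module of syzygies of a proper homogeneous ideal as a quotient of `R`. -/
def MinimalSyzygy.ofIdeal {K : Type*} [Field K] {n : ℕ} (I : Ideal (MvPolynomial (Fin n) K))
    (hI : I ≠ ⊤) (hhom : ∀ p ∈ I, ∀ t, homogeneousComponent t p ∈ I) : MinimalSyzygy K n where
  rank := 1
  deg := fun _ => 0
  carrier := Submodule.comap (LinearMap.proj 0) I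
  homogPart_mem z hz t := by
    rw [Submodule.mem_comap] at hz ⊢
    simpa [homogPart] using hhom _ hz t
  constantCoeff_eq_zero z hz a := by
    by_contra hc
    have h0 : C (constantCoeff (z a)) ∈ I := by
      have := hhom _ hz 0
      rw [Subsingleton.elim a 0]
      rwa [homogeneousComponent_zero] at this
    exact hI (I.eq_top_of_isUnit_mem h0 ((isUnit_iff_ne_zero.2 hc).map C))

/-- Iterated minimal covers of kernels. Existence matters because `gradedBetti` is `0` when there is
no resolution, which would spoil a lower bound for the competitors. -/
theorem nonempty_minimalFreeResolution {K : Type*} [Field K] {n : ℕ}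
    (I : Ideal (MvPolynomial (Fin n) K)) (hI : I ≠ ⊤)
    (hhom : ∀ p ∈ I, ∀ t, homogeneousComponent t p ∈ I) :
    Nonempty (MinimalFreeResolution I) := by
  choose next d h1 h2 h3 using MinimalSyzygy.exists_next (K := K) (n := n)
  let Z : ℕ → MinimalSyzygy K n := fun i =>
    Nat.rec (MinimalSyzygy.ofIdeal I hI hhom) (fun _ Z => next Z) i
  have hmin : ∀ i a b, constantCoeff (d (Z i) (Pi.single b 1) a) = 0 := by
    intro i a b
    refine (Z i).constantCoeff_eq_zero _ ?_ a
    rw [← h2]; exact ⟨_, rfl⟩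
  exact ⟨{
    rank := fun i => (Z i).rank
    deg := fun i => (Z i).deg
    aug := (Submodule.mkQ I).comp (LinearMap.proj (0 : Fin 1))
    diff := fun i => d (Z i)
    aug_homogeneous := fun a => by
      refine ⟨1, isHomogeneous_one _ _, ?_⟩
      have : a = (0 : Fin 1) := Subsingleton.elim (α := Fin 1) _ _
      subst this
      simp
      rfl
    diff_homogeneous := fun i => h1 (Z i)
    aug_surjective := by
      intro x
      obtain ⟨p, rfl⟩ := Submodule.mkQ_surjective I x
      exact ⟨fun _ => p, rfl⟩
    exact_zero := by
      refine (h2 (Z 0)).trans ?_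
      ext z
      rw [LinearMap.mem_ker]
      exact (Submodule.Quotient.mk_eq_zero I).symm
    exact_succ := fun i => (h2 (Z (i + 1))).trans (h3 (Z i)).symm
    minimal := hmin }⟩

/-! ### Hilbert functions and alternating sums of Betti numbers -/

section gradedVec
variable {K : Type*} [Field K] {n r : ℕ}

theorem isHomogeneous_iff_degree {p : MvPolynomial (Fin n) K} {m : ℕ} :
    p.IsHomogeneous m ↔ ∀ s, coeff s p ≠ 0 → s.degree = m := by
  refine ⟨fun h s hs => ?_, fun h s hs => ?_⟩
  · rw [Finsupp.degree_eq_weight_one]; exact h hs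
  · have := h s hs
    rwa [Finsupp.degree_eq_weight_one] at this

/-- The elements of degree `t` of `⨁_a R(-deg a)`. -/
def gradedVec (K : Type*) [Field K] (n : ℕ) {r : ℕ} (deg : Fin r → ℕ) (t : ℕ) :
    Submodule K (Fin r → MvPolynomial (Fin n) K) where
  carrier := {z | IsHomogVec deg t z}
  add_mem' {z w} hz hw a s hs := by
    rw [Pi.add_apply, coeff_add] at hs
    by_cases h : coeff s (z a) = 0
    · exact hw a s (by rwa [h, zero_add] at hs)
    · exact hz a s h
  zero_mem' a s hs := by simp at hs
  smul_mem' c z hz a s hs := by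
    rw [Pi.smul_apply, coeff_smul, smul_eq_mul] at hs
    exact hz a s (right_ne_zero_of_mul hs)

instance finite_homogeneousSubmodule (t : ℕ) :
    Module.Finite K (homogeneousSubmodule (Fin n) K t) :=
  Module.Finite.iff_fg.2 (homogeneousSubmodule_fg (Fin n) K t)

/-- The forms of degree `t - c`. -/
def shiftedForms (K : Type*) [Field K] (n t c : ℕ) : Submodule K (MvPolynomial (Fin n) K) :=
  if c ≤ t then homogeneousSubmodule (Fin n) K (t - c) else ⊥

theorem mem_shiftedForms {t c : ℕ} {p : MvPolynomial (Fin n) K} :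
    p ∈ shiftedForms K n t c ↔ ∀ s, coeff s p ≠ 0 → s.degree + c = t := by
  unfold shiftedForms
  split_ifs with h
  · rw [mem_homogeneousSubmodule]
    rw [isHomogeneous_iff_degree]
    refine forall₂_congr fun s _ => ?_
    omega
  · rw [Submodule.mem_bot]
    constructor
    · rintro rfl s hs; simp at hs
    · intro hp
      ext s
      by_contra hs
      have := hp s hs
      omega

instance finite_shiftedForms (t c : ℕ) : Module.Finite K (shiftedForms K n t c) := by
  by_cases h : c ≤ t
  · rw [shiftedForms, if_pos h]; infer_instance
  · rw [shiftedForms, if_neg h]; infer_instance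

theorem finrank_shiftedForms (t c : ℕ) : Module.finrank K (shiftedForms K n t c) =
    if c ≤ t then Module.finrank K (homogeneousSubmodule (Fin n) K (t - c)) else 0 := by
  by_cases h : c ≤ t
  · rw [shiftedForms, if_pos h, if_pos h]
  · rw [shiftedForms, if_neg h, if_neg h, finrank_bot]

/-- The degree `t` part of a graded free module is the product of its coordinates. -/
def gradedVecEquiv (deg : Fin r → ℕ) (t : ℕ) :
    gradedVec K n deg t ≃ₗ[K] (∀ a, shiftedForms K n t (deg a)) where
  toFun z a := ⟨z.1 a, mem_shiftedForms.2 (z.2 a)⟩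
  invFun w := ⟨fun a => (w a).1, fun a => mem_shiftedForms.1 (w a).2⟩
  map_add' _ _ := rfl
  map_smul' _ _ := rfl
  left_inv _ := rfl
  right_inv _ := rfl

instance finite_gradedVec (deg : Fin r → ℕ) (t : ℕ) : Module.Finite K (gradedVec K n deg t) :=
  Module.Finite.equiv (gradedVecEquiv deg t).symm

theorem finrank_gradedVec (deg : Fin r → ℕ) (t : ℕ) : Module.finrank K (gradedVec K n deg t) =
    ∑ j ∈ Finset.range (t + 1), (Finset.univ.filter fun a => deg a = j).card *
      Module.finrank K (homogeneousSubmodule (Fin n) K (t - j)) := by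
  rw [(gradedVecEquiv deg t).finrank_eq, Module.finrank_pi_fintype]
  simp only [finrank_shiftedForms]
  rw [← Finset.sum_filter, ← Finset.sum_fiberwise_of_maps_to (t := Finset.range (t + 1)) (g := deg)]
  · refine Finset.sum_congr rfl fun j hj => ?_
    rw [Finset.sum_congr rfl (g := fun _ =>
      Module.finrank K (homogeneousSubmodule (Fin n) K (t - j))), Finset.sum_const, smul_eq_mul]
    · congr 2
      ext a
      simp only [Finset.mem_filter, Finset.mem_univ, true_and, Finset.mem_range] at hj ⊢
      omega
    · intro a ha
      rw [(Finset.mem_filter.1 ha).2]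
  · intro a ha
    simp only [Finset.mem_filter, Finset.mem_univ, true_and, Finset.mem_range] at ha ⊢
    omega

/-- The restriction of a homogeneous map to the elements of degree `t`. -/
def IsHomogMap.restrict {r' : ℕ} {deg' : Fin r' → ℕ} {deg : Fin r → ℕ}
    {d : (Fin r' → MvPolynomial (Fin n) K) →ₗ[MvPolynomial (Fin n) K]
      (Fin r → MvPolynomial (Fin n) K)} (hd : IsHomogMap deg' deg d) (t : ℕ) :
    gradedVec K n deg' t →ₗ[K] gradedVec K n deg t :=
  (d.restrictScalars K).restrict (p := gradedVec K n deg' t) (q := gradedVec K n deg t)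
    fun _ hz => hd.map hz

end gradedVec

theorem koszulExact_of_lt {K : Type*} [Field K] {n : ℕ} (I : Ideal (MvPolynomial (Fin n) K))
    {i j : ℕ} (h : j < i) : KoszulExact I i j := by
  intro q hq _
  refine ⟨0, by simp, fun S => ?_⟩
  have : q S = 0 := by
    ext b
    by_contra hb
    have := hq S b hb
    omega
  rw [this]
  simp [koszul]

theorem alternating_sum_of_exact {H : ℕ} {d r : ℕ → ℕ} (h0 : d 0 = H + r 0)
    (hs : ∀ i, d (i + 1) = r i + r (i + 1)) (m : ℕ) :
    ∑ i ∈ Finset.range (m + 1), (-1 : ℤ) ^ i * d i = H + (-1) ^ m * r m := by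
  induction m with
  | zero => simp [h0]
  | succ m ih =>
    rw [Finset.sum_range_succ, ih, hs, pow_succ]
    push_cast
    ring

namespace MinimalFreeResolution
variable {K : Type*} [Field K] {n : ℕ} {I : Ideal (MvPolynomial (Fin n) K)}
  (F : MinimalFreeResolution I)

theorem ker_restrict (i t : ℕ) : LinearMap.ker ((F.isHomogMap i).restrict t) =
    LinearMap.range ((F.isHomogMap (i + 1)).restrict t) := by
  ext ⟨z, hz⟩
  rw [LinearMap.mem_ker, LinearMap.mem_range]
  constructor
  · intro h
    have h1 : F.diff i z = 0 := congrArg Subtype.val h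
    rw [← LinearMap.mem_ker, ← F.exact_succ] at h1
    obtain ⟨w, hw⟩ := h1
    refine ⟨⟨homogPart _ t w, isHomogVec_homogPart _ t w⟩, Subtype.ext ?_⟩
    change F.diff (i + 1) (homogPart _ t w) = z
    rw [(F.isHomogMap (i + 1)).map_homogPart, hw, homogPart_of_isHomogVec hz, if_pos rfl]
  · rintro ⟨w, hw⟩
    have h1 : F.diff (i + 1) w.1 = z := congrArg Subtype.val hw
    refine Subtype.ext ?_
    change F.diff i z = 0
    rw [← LinearMap.mem_ker, ← F.exact_succ]
    exact ⟨_, h1⟩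

/-- The augmentation on the elements of degree `t`. -/
def augRestrict (t : ℕ) : gradedVec K n (F.deg 0) t →ₗ[K] (MvPolynomial (Fin n) K ⧸ I) :=
  (F.aug.restrictScalars K).comp (gradedVec K n (F.deg 0) t).subtype

theorem ker_augRestrict (t : ℕ) : LinearMap.ker (F.augRestrict t) =
    LinearMap.range ((F.isHomogMap 0).restrict t) := by
  ext ⟨z, hz⟩
  rw [LinearMap.mem_ker, LinearMap.mem_range]
  constructor
  · intro h
    have h1 : F.aug z = 0 := h
    rw [← LinearMap.mem_ker, ← F.exact_zero] at h1
    obtain ⟨w, hw⟩ := h1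
    refine ⟨⟨homogPart _ t w, isHomogVec_homogPart _ t w⟩, Subtype.ext ?_⟩
    change F.diff 0 (homogPart _ t w) = z
    rw [(F.isHomogMap 0).map_homogPart, hw, homogPart_of_isHomogVec hz, if_pos rfl]
  · rintro ⟨w, hw⟩
    have h1 : F.diff 0 w.1 = z := congrArg Subtype.val hw
    change F.aug z = 0
    rw [← LinearMap.mem_ker, ← F.exact_zero]
    exact ⟨_, h1⟩

/-- The augmentation lifts to a homogeneous map `F_0 → R`. The part of degree `t` of any preimage of
a form of degree `t` is again a preimage, because `I` contains the homogeneous components of its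
elements. -/
theorem range_augRestrict (hhom : ∀ p ∈ I, ∀ t, homogeneousComponent t p ∈ I) (t : ℕ) :
    LinearMap.range (F.augRestrict t) = gradedPiece I t := by
  have hg : ∀ a, ∃ g : MvPolynomial (Fin n) K, g ∈ homogeneousSubmodule (Fin n) K (F.deg 0 a) ∧
      Ideal.Quotient.mk I g = F.aug (Pi.single a 1) := fun a => F.aug_homogeneous a
  choose g hg1 hg2 using hg
  set d := Fintype.linearCombination (MvPolynomial (Fin n) K)
    (fun a (_ : Fin 1) => g a) with hd
  have hdapp : ∀ z, d z 0 = ∑ a, z a * g a := by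
    intro z
    rw [hd, Fintype.linearCombination_apply, Finset.sum_apply]
    rfl
  have hdhom : IsHomogMap (F.deg 0) (fun _ : Fin 1 => 0) d := by
    intro a b s hs
    rw [hd, Fintype.linearCombination_apply_single, one_smul] at hs
    exact isHomogeneous_iff_degree.1 (hg1 b) s hs
  have haug : ∀ z, F.aug z = Ideal.Quotient.mk I (d z 0) := by
    intro z
    rw [map_eq_sum_single, hdapp, map_sum]
    refine Finset.sum_congr rfl fun a _ => ?_
    rw [← hg2]
    rfl
  have hpart : ∀ v : Fin 1 → MvPolynomial (Fin n) K,
      homogPart (fun _ => 0) t v 0 = homogeneousComponent t (v 0) := by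
    intro v; simp [homogPart]
  ext x
  rw [LinearMap.mem_range]
  constructor
  · rintro ⟨⟨z, hz⟩, rfl⟩
    refine ⟨d z 0, ?_, (haug z).symm⟩
    have h1 : IsHomogVec (fun _ : Fin 1 => 0) t (d z) := hdhom.map hz
    exact isHomogeneous_iff_degree.2 fun s hs => h1 0 s hs
  · rintro ⟨p, hp, rfl⟩
    obtain ⟨z, hz⟩ := F.aug_surjective (Ideal.Quotient.mk I p)
    refine ⟨⟨homogPart _ t z, isHomogVec_homogPart _ t z⟩, ?_⟩
    change F.aug (homogPart _ t z) = Ideal.Quotient.mk I p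
    rw [haug] at hz ⊢
    rw [hdhom.map_homogPart, hpart]
    rw [Ideal.Quotient.eq] at hz ⊢
    have h1 := hhom _ hz t
    rwa [map_sub, homogeneousComponent_of_mem hp, if_pos rfl] at h1

theorem finrank_gradedVec_zero (hhom : ∀ p ∈ I, ∀ t, homogeneousComponent t p ∈ I) (t : ℕ) :
    Module.finrank K (gradedVec K n (F.deg 0) t) = hilbertFunction I t +
      Module.finrank K (LinearMap.range ((F.isHomogMap 0).restrict t)) := by
  rw [← F.ker_augRestrict, hilbertFunction, ← F.range_augRestrict hhom,
    LinearMap.finrank_range_add_finrank_ker]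

theorem finrank_gradedVec_succ (i t : ℕ) :
    Module.finrank K (gradedVec K n (F.deg (i + 1)) t) =
      Module.finrank K (LinearMap.range ((F.isHomogMap i).restrict t)) +
      Module.finrank K (LinearMap.range ((F.isHomogMap (i + 1)).restrict t)) := by
  rw [← F.ker_restrict, LinearMap.finrank_range_add_finrank_ker]

/-- The Euler characteristic of the resolution in degree `t`. Truncation at `m ≥ t` is harmless. -/
theorem hilbertFunction_eq_sum (hhom : ∀ p ∈ I, ∀ t, homogeneousComponent t p ∈ I) {m t : ℕ}
    (htm : t ≤ m) : (hilbertFunction I t : ℤ) = ∑ j ∈ Finset.range (t + 1),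
      (∑ i ∈ Finset.range (m + 1), (-1 : ℤ) ^ i * F.betti i j) *
        Module.finrank K (homogeneousSubmodule (Fin n) K (t - j)) := by
  have h1 := alternating_sum_of_exact
    (d := fun i => Module.finrank K (gradedVec K n (F.deg i) t))
    (r := fun i => Module.finrank K (LinearMap.range ((F.isHomogMap i).restrict t)))
    (F.finrank_gradedVec_zero hhom t) (F.finrank_gradedVec_succ · t) m
  -- As `t ≤ m`, the module `F_{m+1}` has no generators of degree at most `t` and vanishes in degree
  -- `t`.
  have h2 : Module.finrank K (LinearMap.range ((F.isHomogMap m).restrict t)) = 0 := by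
    have h3 := F.finrank_gradedVec_succ m t
    have h4 : Module.finrank K (gradedVec K n (F.deg (m + 1)) t) = 0 := by
      rw [finrank_gradedVec]
      refine Finset.sum_eq_zero fun j hj => ?_
      have h5 : F.betti (m + 1) j = 0 :=
        F.betti_eq_zero (koszulExact_of_lt I (by rw [Finset.mem_range] at hj; omega))
      unfold betti at h5
      rw [h5, zero_mul]
    omega
  rw [h2] at h1
  simp only [finrank_gradedVec] at h1
  push_cast at h1
  rw [mul_zero, add_zero] at h1
  rw [← h1]
  simp only [Finset.mul_sum, Finset.sum_mul]
  rw [Finset.sum_comm]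
  refine Finset.sum_congr rfl fun j _ => Finset.sum_congr rfl fun i _ => ?_
  unfold betti
  ring

end MinimalFreeResolution

theorem finrank_homogeneousSubmodule_zero (K : Type*) [Field K] (n : ℕ) :
    Module.finrank K (homogeneousSubmodule (Fin n) K 0) = 1 := by
  have : homogeneousSubmodule (Fin n) K 0 = Submodule.span K {1} := by
    ext p
    rw [mem_homogeneousSubmodule, Submodule.mem_span_singleton]
    constructor
    · intro hp
      refine ⟨coeff 0 p, ?_⟩
      have h := homogeneousComponent_of_mem (mem_homogeneousSubmodule 0 p |>.2 hp) (m := 0)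
      rw [if_pos rfl, homogeneousComponent_zero] at h
      rw [smul_eq_C_mul, mul_one, h]
    · rintro ⟨c, rfl⟩
      rw [smul_eq_C_mul, mul_one]
      exact isHomogeneous_C _ _
  rw [this, finrank_span_singleton one_ne_zero]

/-- The expansion of the Hilbert function is triangular in `j` with diagonal entries `dim R_0 = 1`,
so the alternating sums are recovered one degree at a time. -/
theorem alternating_betti_eq {K : Type*} [Field K] {n : ℕ} {I J : Ideal (MvPolynomial (Fin n) K)}
    (F : MinimalFreeResolution I) (G : MinimalFreeResolution J)
    (hI : ∀ p ∈ I, ∀ t, homogeneousComponent t p ∈ I)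
    (hJ : ∀ p ∈ J, ∀ t, homogeneousComponent t p ∈ J)
    (h : hilbertFunction I = hilbertFunction J) {j m : ℕ} (hjm : j ≤ m) :
    ∑ i ∈ Finset.range (m + 1), (-1 : ℤ) ^ i * F.betti i j =
      ∑ i ∈ Finset.range (m + 1), (-1 : ℤ) ^ i * G.betti i j := by
  induction j using Nat.strong_induction_on with
  | _ j ih =>
    have h1 := F.hilbertFunction_eq_sum hI hjm
    have h2 := G.hilbertFunction_eq_sum hJ hjm
    rw [h, h2, Finset.sum_range_succ _ j, Finset.sum_range_succ _ j, Nat.sub_self,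
      finrank_homogeneousSubmodule_zero] at h1
    have h3 : ∀ k ∈ Finset.range j, (∑ i ∈ Finset.range (m + 1), (-1 : ℤ) ^ i * F.betti i k) *
        (Module.finrank K (homogeneousSubmodule (Fin n) K (j - k)) : ℤ) =
        (∑ i ∈ Finset.range (m + 1), (-1 : ℤ) ^ i * G.betti i k) *
        (Module.finrank K (homogeneousSubmodule (Fin n) K (j - k)) : ℤ) := fun k hk => by
      rw [ih k (Finset.mem_range.1 hk) ((Finset.mem_range.1 hk).le.trans hjm)]
    rw [Finset.sum_congr rfl h3, Nat.cast_one, mul_one, mul_one] at h1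
    exact (add_left_cancel h1).symm

/-! ### Squarefree strands as cochain complexes of induced subcomplexes -/

section strands
variable {K : Type*} [Field K] {n : ℕ}

/-- The subsets of `W` whose complement in `W` belongs to `Γ`. -/
def complStrand (Γ : Set (Finset (Fin n))) (W : Finset (Fin n)) : Set (Finset (Fin n)) :=
  {S | S ⊆ W ∧ W \ S ∈ Γ}

theorem sum_compl_eq_sum_sdiff {Γ : Set (Finset (Fin n))} {W T : Finset (Fin n)}
    {φ : Finset (Fin n) → K} (hφ : ∀ S, φ S ≠ 0 → S ∈ complStrand Γ W) :
    ∑ v ∈ Tᶜ, insertSign v T • φ (insert v T) = ∑ v ∈ W \ T, insertSign v T • φ (insert v T) := by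
  symm
  refine Finset.sum_subset (fun v hv => by simp at hv ⊢; exact hv.2) fun v _ hv => ?_
  refine (congrArg _ ?_).trans (smul_zero _)
  by_contra hne
  have h1 := (hφ _ hne).1 (Finset.mem_insert_self v T)
  simp_all

/-- Taking complements in `W` turns the strand into the augmented cochain complex of `Γ` restricted
to `W`. This is its degree `-1`: a cocycle on the empty face vanishes as soon as `W` has a vertex.
-/
theorem exactAt_of_card_eq {Γ : Set (Finset (Fin n))} (h1 : ∀ v, {v} ∈ Γ) {W : Finset (Fin n)}
    {i : ℕ} (hW : W.card = i + 1) : ExactAt K (complStrand Γ W) (i + 1) := by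
  intro φ hφ hcyc
  have hW0 : ∀ S ∈ complStrand Γ W, φ S = 0 := by
    intro S hS
    by_contra hne
    have hSW : S = W := Finset.eq_of_subset_of_card_le hS.1 (by rw [(hφ S hne).2, hW])
    subst hSW
    obtain ⟨v, hv⟩ := Finset.card_pos.1 (by omega : 0 < S.card)
    have hsd : S \ S.erase v = {v} := by
      ext x; simp only [Finset.mem_sdiff, Finset.mem_erase, Finset.mem_singleton]
      constructor
      · rintro ⟨h, h'⟩; by_contra hx; exact h' ⟨hx, h⟩
      · rintro rfl; exact ⟨hv, by simp⟩
    have h2 := hcyc (S.erase v) ⟨Finset.erase_subset _ _, by rw [hsd]; exact h1 v⟩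
    rw [sum_compl_eq_sum_sdiff (fun T hT => (hφ T hT).1), hsd,
      Finset.sum_singleton, Finset.insert_erase hv] at h2
    apply hne
    have := congrArg (insertSign v (S.erase v) • ·) h2
    simpa only [smul_smul, insertSign_mul_self, one_smul, smul_zero] using this
  refine ⟨0, by simp, fun S hS => ?_⟩
  rw [hW0 S hS]
  simp

/-- Only `∅` can carry a value, and then `W` itself is a face, so its value comes from the face of
`W` opposite to any vertex `v`. -/
theorem exactAt_zero {Γ : Set (Finset (Fin n))} (hlow : ∀ F ∈ Γ, ∀ G ⊆ F, G ∈ Γ)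
    {W : Finset (Fin n)} (hW : W.Nonempty) : ExactAt K (complStrand Γ W) 0 := by
  intro φ hφ _
  obtain ⟨v, hv⟩ := hW
  refine ⟨fun S => if S = {v} then φ ∅ else 0, ?_, ?_⟩
  · intro S hS
    by_cases h : S = {v}
    · subst h
      beta_reduce at hS
      rw [if_pos rfl] at hS
      refine ⟨⟨by simpa using hv, hlow _ (hφ _ hS).1.2 _ ?_⟩, by simp⟩
      exact Finset.sdiff_subset_sdiff subset_rfl (Finset.empty_subset _)
    · simp [h] at hS
  · intro S hS
    by_cases h : S = ∅
    · subst h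
      rw [Finset.sum_eq_single_of_mem v (by simp)]
      · simp [insertSign_empty]
      · intro u _ hu
        beta_reduce
        rw [if_neg (by simpa using hu), smul_zero]
    · have hφS : φ S = 0 := by
        by_contra hne
        exact h (Finset.card_eq_zero.1 (hφ S hne).2)
      rw [hφS]
      refine Finset.sum_eq_zero fun u hu => ?_
      beta_reduce
      rw [if_neg, smul_zero]
      intro he
      have hc := congrArg Finset.card he
      rw [Finset.card_insert_of_notMem (by simpa using hu), Finset.card_singleton] at hc
      exact h (Finset.card_eq_zero.1 (by omega))

/-- The complements of the sets of size `i` are edges here: vanishing of `H^1` means that every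
function on oriented edges is the difference of a function on the vertices. -/
theorem exactAt_of_potential {Γ : Set (Finset (Fin n))} (h1 : ∀ v, {v} ∈ Γ)
    {W : Finset (Fin n)} {i : ℕ} (hW : W.card = i + 2)
    (hpot : ∀ c : Fin n → Fin n → K, (∀ u w, u ≠ w → c w u = -c u w) →
      ∃ f : Fin n → K, ∀ u ∈ W, ∀ w ∈ W, u ≠ w → {u, w} ∈ Γ → f w - f u = c u w) :
    ExactAt K (complStrand Γ W) i := by
  classical
  intro φ hφ _
  -- The product of the two insertion signs turns values on unordered edges into an antisymmetric
  -- function of the endpoints.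
  obtain ⟨f, hf⟩ := hpot (fun u w => (insertSign u (W \ {u, w}) *
    insertSign w (insert u (W \ {u, w}))) • φ (W \ {u, w})) (by
      intro u w huw
      rw [Finset.pair_comm w u, insertSign_swap huw (by simp) (by simp), neg_smul])
  set ψ : Finset (Fin n) → K := fun S =>
    ∑ v ∈ W, if S = W.erase v then insertSign v (W.erase v) • f v else 0 with hψ
  have hψe : ∀ v ∈ W, ψ (W.erase v) = insertSign v (W.erase v) • f v := by
    intro v hv
    rw [hψ]
    beta_reduce
    rw [Finset.sum_eq_single_of_mem v hv, if_pos rfl]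
    intro u hu huv
    rw [if_neg]
    intro h
    have : v ∈ W.erase u := Finset.mem_erase.2 ⟨huv.symm, hv⟩
    rw [← h] at this
    simp at this
  have hψs : ∀ S, ψ S ≠ 0 → ∃ v ∈ W, S = W.erase v := by
    intro S hS
    obtain ⟨v, hv, hne⟩ := Finset.exists_ne_zero_of_sum_ne_zero hS
    refine ⟨v, hv, ?_⟩
    by_contra h
    exact hne (if_neg h)
  have hψsupp : ∀ S, ψ S ≠ 0 → S ∈ complStrand Γ W ∧ S.card = i + 1 := by
    intro S hS
    obtain ⟨v, hv, rfl⟩ := hψs S hS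
    refine ⟨⟨Finset.erase_subset _ _, ?_⟩, by rw [Finset.card_erase_of_mem hv, hW]; rfl⟩
    have hsd : W \ W.erase v = {v} := by
      ext x; simp only [Finset.mem_sdiff, Finset.mem_erase, Finset.mem_singleton]
      constructor
      · rintro ⟨h, h'⟩; by_contra hx; exact h' ⟨hx, h⟩
      · rintro rfl; exact ⟨hv, by simp⟩
    rw [hsd]; exact h1 v
  refine ⟨ψ, hψsupp, fun S hS => ?_⟩
  rw [sum_compl_eq_sum_sdiff (fun T hT => (hψsupp T hT).1)]
  by_cases hSi : S.card = i
  · have hc : (W \ S).card = 2 := by rw [Finset.card_sdiff_of_subset hS.1]; omega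
    obtain ⟨u, w, huw, he⟩ := Finset.card_eq_two.1 hc
    have hu : u ∈ W ∧ u ∉ S := Finset.mem_sdiff.1 (he ▸ by simp)
    have hw : w ∈ W ∧ w ∉ S := Finset.mem_sdiff.1 (he ▸ by simp)
    have hSe : S = W \ {u, w} := by rw [← he, Finset.sdiff_sdiff_eq_self hS.1]
    have hiu : insert u S = W.erase w := by
      rw [hSe]; ext x
      simp only [Finset.mem_insert, Finset.mem_sdiff, Finset.mem_singleton, Finset.mem_erase]
      by_cases hx : x = u
      · subst hx; simp [huw, hu.1]
      · simp only [hx, false_or]; tauto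
    have hiw : insert w S = W.erase u := by
      rw [hSe]; ext x
      simp only [Finset.mem_insert, Finset.mem_sdiff, Finset.mem_singleton, Finset.mem_erase]
      by_cases hx : x = w
      · subst hx; simp [huw.symm, hw.1]
      · simp only [hx, false_or]; tauto
    have h2 := hf u hu.1 w hw.1 huw (he ▸ hS.2)
    beta_reduce at h2
    rw [← hSe] at h2
    have hsw := insertSign_swap huw hu.2 hw.2
    rw [he, Finset.sum_pair huw, hiu, hiw, hψe w hw.1, hψe u hu.1, ← hiu, ← hiw, smul_smul,
      smul_smul, hsw, neg_smul, ← sub_eq_add_neg, ← smul_sub, h2, smul_smul]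
    have e1 := insertSign_mul_self u S
    have e2 := insertSign_mul_self w (insert u S)
    have e3 : insertSign u S * insertSign w (insert u S) *
        (insertSign u S * insertSign w (insert u S)) = 1 := by
      linear_combination insertSign w (insert u S) * insertSign w (insert u S) * e1 + e2
    rw [e3, one_smul]
  · have hφS : φ S = 0 := by
      by_contra hne
      exact hSi (hφ S hne).2
    rw [hφS]
    refine Finset.sum_eq_zero fun v hv => ?_
    refine (congrArg _ ?_).trans (smul_zero _)
    by_contra hne
    have := (hψsupp _ hne).2
    rw [Finset.card_insert_of_notMem (Finset.mem_sdiff.1 hv).2] at this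
    omega

/-- The complements of the sets of size `i` are vertices here: vanishing of reduced `H^0` means that
a function constant along edges is constant. -/
theorem exactAt_of_connected {Γ : Set (Finset (Fin n))} (h0 : ∅ ∈ Γ)
    {W : Finset (Fin n)} {i : ℕ} (hW : W.card = i + 1)
    (hconn : ∀ g : Fin n → K, (∀ u ∈ W, ∀ w ∈ W, u ≠ w → {u, w} ∈ Γ → g u = g w) →
      ∃ c, ∀ u ∈ W, g u = c) :
    ExactAt K (complStrand Γ W) i := by
  classical
  intro φ hφ hcyc
  -- After the twist by the insertion sign, the cocycle condition at the complement of an edge says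
  -- that the values at its two ends agree.
  obtain ⟨c, hc⟩ := hconn (fun v => insertSign v (W.erase v) • φ (W.erase v)) (by
    intro u hu w hw huw he
    set T := W \ {u, w} with hT
    have hsd : W \ T = {u, w} := Finset.sdiff_sdiff_eq_self (by
      intro x hx; simp at hx; rcases hx with rfl | rfl <;> assumption)
    have hiu : insert u T = W.erase w := by
      rw [hT]; ext x
      simp only [Finset.mem_insert, Finset.mem_sdiff, Finset.mem_singleton, Finset.mem_erase]
      by_cases hx : x = u
      · subst hx; simp [huw, hu]
      · simp only [hx, false_or]; tauto
    have hiw : insert w T = W.erase u := by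
      rw [hT]; ext x
      simp only [Finset.mem_insert, Finset.mem_sdiff, Finset.mem_singleton, Finset.mem_erase]
      by_cases hx : x = w
      · subst hx; simp [huw.symm, hw]
      · simp only [hx, false_or]; tauto
    have h2 := hcyc T ⟨Finset.sdiff_subset, by rw [hsd]; exact he⟩
    rw [sum_compl_eq_sum_sdiff (fun S hS => (hφ S hS).1), hsd,
      Finset.sum_pair huw] at h2
    have hsw := insertSign_swap (S := T) huw (by simp [hT]) (by simp [hT])
    rw [← hiu, ← hiw]
    have e1 := insertSign_mul_self u T
    have e2 := insertSign_mul_self w T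
    simp only [zsmul_eq_mul] at h2 ⊢
    have hsw' := congrArg (Int.cast (R := K)) hsw
    have e1' := congrArg (Int.cast (R := K)) e1
    have e2' := congrArg (Int.cast (R := K)) e2
    push_cast at hsw' e1' e2'
    linear_combination
      -(insertSign u T * insertSign w (insert u T) : K) * h2
      + insertSign w T * φ (insert w T) * hsw'
      + insertSign w (insert u T) * φ (insert u T) * e1'
      - insertSign u (insert w T) * φ (insert w T) * e2')
  set ψ : Finset (Fin n) → K := fun S => if S = W then c else 0 with hψ
  have hψs : ∀ S, ψ S ≠ 0 → S = W := by
    intro S hS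
    by_contra h
    exact hS (if_neg h)
  have hψsupp : ∀ S, ψ S ≠ 0 → S ∈ complStrand Γ W ∧ S.card = i + 1 := by
    intro S hS
    obtain rfl := hψs S hS
    exact ⟨⟨subset_rfl, by rwa [Finset.sdiff_self]⟩, hW⟩
  refine ⟨ψ, hψsupp, fun S hS => ?_⟩
  rw [sum_compl_eq_sum_sdiff (fun T hT => (hψsupp T hT).1)]
  by_cases hSi : S.card = i
  · have hc1 : (W \ S).card = 1 := by rw [Finset.card_sdiff_of_subset hS.1]; omega
    obtain ⟨v, hv⟩ := Finset.card_eq_one.1 hc1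
    have hvW : v ∈ W ∧ v ∉ S := Finset.mem_sdiff.1 (hv ▸ by simp)
    have hiv : insert v S = W := by
      rw [Finset.insert_eq, ← hv, Finset.sdiff_union_of_subset hS.1]
    have hSe : W.erase v = S := by rw [← hiv, Finset.erase_insert hvW.2]
    rw [hv, Finset.sum_singleton, hiv, hψ]
    beta_reduce
    rw [if_pos rfl, ← hc v hvW.1]
    rw [hSe, smul_smul, insertSign_mul_self, one_smul]
  · have hφS : φ S = 0 := by
      by_contra hne
      exact hSi (hφ S hne).2
    rw [hφS]
    refine Finset.sum_eq_zero fun v hv => ?_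
    refine (congrArg _ ?_).trans (smul_zero _)
    by_contra hne
    have := (hψsupp _ hne).2
    rw [Finset.card_insert_of_notMem (Finset.mem_sdiff.1 hv).2] at this
    omega

end strands

/-! ### Squarefree monomial ideals, Hochster's reduction and the comparison -/

section faces
variable {K : Type*} [Field K] {n : ℕ}

/-- `I` is the squarefree monomial ideal with the faces `Γ`: the supports of the monomials that
are not in `I`. -/
def IsFaceSet (I : Ideal (MvPolynomial (Fin n) K)) (Γ : Set (Finset (Fin n))) : Prop :=
  (∀ F ∈ Γ, ∀ G ⊆ F, G ∈ Γ) ∧ ∀ p, p ∈ I ↔ ∀ b : Fin n →₀ ℕ, b.support ∈ Γ → coeff b p = 0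

theorem prod_X_eq_monomial (s : Finset (Fin n)) :
    ∏ v ∈ s, (X v : MvPolynomial (Fin n) K) = monomial (indicatorVec s) 1 :=
  (monomial_sum_one s _).symm

theorem indicatorVec_le_iff {s : Finset (Fin n)} {b : Fin n →₀ ℕ} :
    indicatorVec s ≤ b ↔ s ⊆ b.support := by
  rw [Finsupp.le_def]
  constructor
  · intro h v hv
    have := h v
    rw [indicatorVec_apply, if_pos hv] at this
    simp; omega
  · intro h v
    rw [indicatorVec_apply]
    split_ifs with hv
    · have := h hv
      simp at this; omega
    · omega

theorem isFaceSet_span (S : Set (Finset (Fin n))) :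
    IsFaceSet (Ideal.span ((fun s : Finset (Fin n) =>
      ∏ v ∈ s, (X v : MvPolynomial (Fin n) K)) '' S)) {F | ∀ s ∈ S, ¬ s ⊆ F} := by
  refine ⟨fun F hF G hG s hs hsG => hF s hs (hsG.trans hG), fun p => ?_⟩
  have h1 : (fun s : Finset (Fin n) => ∏ v ∈ s, (X v : MvPolynomial (Fin n) K)) '' S =
      (fun b => monomial b 1) '' (indicatorVec '' S) := by
    rw [Set.image_image]
    exact Set.image_congr fun s _ => prod_X_eq_monomial s
  rw [h1, mem_ideal_span_monomial_image]
  simp only [Set.mem_image, exists_exists_and_eq_and, indicatorVec_le_iff, mem_support_iff,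
    Set.mem_ofPred_eq]
  refine forall_congr' fun b => ⟨fun h hb => ?_, fun h hb => ?_⟩
  · by_contra hne
    obtain ⟨s, hs, hsb⟩ := h hne
    exact hb s hs hsb
  · by_contra hcon
    push Not at hcon
    exact hb (h hcon)

theorem IsSquarefreeMonomialIdeal.exists_isFaceSet {I : Ideal (MvPolynomial (Fin n) K)}
    (h : IsSquarefreeMonomialIdeal I) : ∃ Γ, IsFaceSet I Γ := by
  obtain ⟨S, rfl⟩ := h
  exact ⟨_, isFaceSet_span S⟩

variable {I : Ideal (MvPolynomial (Fin n) K)} {Γ : Set (Finset (Fin n))}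

theorem IsFaceSet.homogeneousComponent_mem (h : IsFaceSet I Γ) :
    ∀ p ∈ I, ∀ t, homogeneousComponent t p ∈ I := by
  intro p hp t
  rw [h.2] at hp ⊢
  intro b hb
  rw [coeff_homogeneousComponent, hp b hb, ite_self]

theorem IsFaceSet.ne_top (h : IsFaceSet I Γ) (h0 : ∅ ∈ Γ) : I ≠ ⊤ := by
  rw [Ideal.ne_top_iff_one, h.2]
  intro hc
  simpa using hc 0 (by simpa using h0)

theorem IsFaceSet.nonempty_resolution (h : IsFaceSet I Γ) (h0 : ∅ ∈ Γ) :
    Nonempty (MinimalFreeResolution I) :=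
  nonempty_minimalFreeResolution I (h.ne_top h0) h.homogeneousComponent_mem

/-- The vanishing half of Hochster's formula: non-squarefree multidegrees never contribute, and the
squarefree multidegree of `W` gives the strand of `W`. -/
theorem IsFaceSet.koszulExact (h : IsFaceSet I Γ) {i j : ℕ}
    (hW : ∀ W : Finset (Fin n), W.card = j → ExactAt K (complStrand Γ W) i) :
    KoszulExact I i j := by
  classical
  refine koszulExact_of_strand (N := {b | b.support ∈ Γ}) (fun p => h.2 p) fun a ha => ?_
  -- If `a v ≥ 2`, then `v` stays in the support of the remaining monomial whether or not it lies in
  -- `S`, so toggling `v` does not affect membership in `Γ`.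
  by_cases hv : ∃ v, 2 ≤ a v
  · obtain ⟨v, hv⟩ := hv
    refine exactAt_of_toggle v ?_ ?_ i
    · rintro S ⟨b, hb, rfl⟩
      rw [Finsupp.add_apply, indicatorVec_apply] at hv
      by_cases hvS : v ∈ S
      · rw [Finset.insert_eq_of_mem hvS]; exact ⟨b, hb, rfl⟩
      · rw [if_neg hvS] at hv
        have hle : Finsupp.single v 1 ≤ b := by
          rw [Finsupp.single_le_iff]; omega
        refine ⟨b - Finsupp.single v 1, h.1 _ hb _ ?_, ?_⟩
        · exact Finsupp.support_mono tsub_le_self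
        · rw [indicatorVec_insert hvS, ← add_assoc, tsub_add_cancel_of_le hle]
    · rintro S ⟨b, hb, rfl⟩
      rw [Finsupp.add_apply, indicatorVec_apply] at hv
      by_cases hvS : v ∈ S
      · rw [if_pos hvS] at hv
        refine ⟨b + Finsupp.single v 1, ?_, ?_⟩
        · have : (b + Finsupp.single v 1).support = b.support := by
            ext x
            simp only [Finsupp.mem_support_iff, Finsupp.add_apply, Finsupp.single_apply]
            split_ifs with hx
            · subst hx; omega
            · simp
          rw [Set.mem_ofPred_eq, this]; exact hb
        · rw [add_assoc, ← indicatorVec_insert (Finset.notMem_erase v S), Finset.insert_erase hvS]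
      · rw [Finset.erase_eq_of_notMem hvS]; exact ⟨b, hb, rfl⟩
  · push Not at hv
    have haW : a = indicatorVec a.support := by
      ext v
      rw [indicatorVec_apply]
      have := hv v
      by_cases hz : a v = 0
      · simp [hz]
      · rw [if_pos (by simpa using hz)]; omega
    have hstr : strand {b : Fin n →₀ ℕ | b.support ∈ Γ} a = complStrand Γ a.support := by
      ext S
      constructor
      · rintro ⟨b, hb, rfl⟩
        have hsub : S ⊆ (b + indicatorVec S).support := by
          rw [← indicatorVec_le_iff]; exact le_add_self
        refine ⟨hsub, ?_⟩
        have he : (b + indicatorVec S).support \ S = b.support := by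
          ext v
          have hv' := hv v
          rw [Finsupp.add_apply, indicatorVec_apply] at hv'
          simp only [Finset.mem_sdiff, Finsupp.mem_support_iff, Finsupp.add_apply,
            indicatorVec_apply]
          split_ifs at hv' ⊢ with hvS
          · simp [hvS]; omega
          · simp [hvS]
        rw [he]; exact hb
      · rintro ⟨hS, hΓ⟩
        refine ⟨indicatorVec (a.support \ S), ?_, ?_⟩
        · rw [Set.mem_ofPred_eq]
          have he : (indicatorVec (a.support \ S)).support = a.support \ S := by
            ext v
            rw [Finsupp.mem_support_iff, indicatorVec_apply]
            simp
          rw [he]; exact hΓ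
        · rw [haW]
          ext v
          have hv' := @hS v
          rw [← haW, Finsupp.add_apply, indicatorVec_apply, indicatorVec_apply, haW,
            indicatorVec_apply, ← haW]
          simp only [Finset.mem_sdiff]
          by_cases hvS : v ∈ S
          · simp [hvS, hv' hvS]
          · simp [hvS]
    rw [hstr]
    refine hW _ ?_
    rw [← ha, ← degree_indicatorVec, ← haW]

/-- `I` is the Stanley–Reisner ideal of a complex of dimension at most one, all of whose vertices
are faces. -/
structure IsGraphIdeal (I : Ideal (MvPolynomial (Fin n) K)) (Γ : Set (Finset (Fin n))) : Prop where
  isFaceSet : IsFaceSet I Γ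
  empty_mem : ∅ ∈ Γ
  singleton_mem : ∀ v, {v} ∈ Γ
  card_le : ∀ F ∈ Γ, F.card ≤ 2

/-- Relevant faces have `j - i` elements: none for `j < i` or `j > i + 2`, and for `j = i` only the
empty face, which has no cohomology over a nonempty `W`. -/
theorem IsGraphIdeal.koszulExact (h : IsGraphIdeal I Γ) {i j : ℕ} (h0 : ¬(i = 0 ∧ j = 0))
    (h1 : j ≠ i + 1) (h2 : j ≠ i + 2) : KoszulExact I i j := by
  rcases lt_trichotomy j i with hj | hj | hj
  · exact koszulExact_of_lt I hj
  · subst hj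
    obtain ⟨k, rfl⟩ : ∃ k, j = k + 1 := ⟨j - 1, by omega⟩
    exact h.isFaceSet.koszulExact fun W hW => exactAt_of_card_eq h.singleton_mem hW
  · refine h.isFaceSet.koszulExact fun W hW => exactAt_of_card_ne fun S hS hSi => ?_
    have := h.card_le _ hS.2
    rw [Finset.card_sdiff_of_subset hS.1] at this
    omega

/-- In degree `k + 2` only the homological degrees `k` and `k + 1` occur, and the difference of the
two Betti numbers is prescribed. A pair of natural numbers with given difference is least when one
of them is zero. In degrees `0` and `1` a single Betti number remains and is itself prescribed. -/
theorem IsGraphIdeal.gradedBetti_le (hI : IsGraphIdeal I Γ)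
    (hlin : ∀ i, KoszulExact I (i + 1) (i + 2) ∨ KoszulExact I i (i + 2))
    {J : Ideal (MvPolynomial (Fin n) K)} {Γ' : Set (Finset (Fin n))} (hJ : IsGraphIdeal J Γ')
    (hH : hilbertFunction J = hilbertFunction I) (i j : ℕ) :
    gradedBetti I i j ≤ gradedBetti J i j := by
  have hF := hI.isFaceSet.nonempty_resolution hI.empty_mem
  have hG := hJ.isFaceSet.nonempty_resolution hJ.empty_mem
  rw [gradedBetti, dif_pos hF, gradedBetti, dif_pos hG]
  generalize hF.some = F
  generalize hG.some = G
  have hF0 : ∀ {i j : ℕ}, ¬(i = 0 ∧ j = 0) → j ≠ i + 1 → j ≠ i + 2 → F.betti i j = 0 :=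
    fun h0 h1 h2 => F.betti_eq_zero (hI.koszulExact h0 h1 h2)
  have hG0 : ∀ {i j : ℕ}, ¬(i = 0 ∧ j = 0) → j ≠ i + 1 → j ≠ i + 2 → G.betti i j = 0 :=
    fun h0 h1 h2 => G.betti_eq_zero (hJ.koszulExact h0 h1 h2)
  have halt := fun j => alternating_betti_eq F G hI.isFaceSet.homogeneousComponent_mem
    hJ.isFaceSet.homogeneousComponent_mem hH.symm (le_refl j)
  by_cases hspec : ¬(i = 0 ∧ j = 0) ∧ j ≠ i + 1 ∧ j ≠ i + 2
  · rw [hF0 hspec.1 hspec.2.1 hspec.2.2]; exact Nat.zero_le _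
  match j with
  | 0 =>
    have hi : i = 0 := by omega
    subst hi
    have := halt 0
    simp at this
    omega
  | 1 =>
    have hi : i = 0 := by omega
    subst hi
    have := halt 1
    simp only [Finset.sum_range_succ, Finset.range_zero, Finset.sum_empty] at this
    rw [hF0 (i := 1) (j := 1) (by omega) (by omega) (by omega),
      hG0 (i := 1) (j := 1) (by omega) (by omega) (by omega)] at this
    simp at this
    omega
  | k + 2 =>
    have h1 := halt (k + 2)
    rw [Finset.sum_range_succ, Finset.sum_range_succ, Finset.sum_range_succ,
      Finset.sum_range_succ _ (k + 2), Finset.sum_range_succ _ (k + 1), Finset.sum_range_succ _ k,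
      Finset.sum_eq_zero, Finset.sum_eq_zero,
      hF0 (i := k + 2) (by omega) (by omega) (by omega),
      hG0 (i := k + 2) (by omega) (by omega) (by omega)] at h1
    · have h2 : (F.betti k (k + 2) : ℤ) - F.betti (k + 1) (k + 2) =
          G.betti k (k + 2) - G.betti (k + 1) (k + 2) := by
        have h3 : ((-1 : ℤ) ^ k) * (-1) ^ k = 1 := by rw [← mul_pow]; norm_num
        simp only [pow_succ] at h1
        push_cast at h1
        linear_combination ((-1 : ℤ) ^ k) * h1 - ((F.betti k (k + 2) : ℤ) -
          F.betti (k + 1) (k + 2) - G.betti k (k + 2) + G.betti (k + 1) (k + 2)) * h3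
      have h4 : F.betti (k + 1) (k + 2) = 0 ∨ F.betti k (k + 2) = 0 :=
        (hlin k).imp (fun h => F.betti_eq_zero h) (fun h => F.betti_eq_zero h)
      have hi : i = k ∨ i = k + 1 := by omega
      rcases hi with rfl | rfl <;> rcases h4 with h4 | h4 <;> omega
    · intro x hx
      rw [hG0 (by omega) (by rw [Finset.mem_range] at hx; omega)
        (by rw [Finset.mem_range] at hx; omega)]
      simp
    · intro x hx
      rw [hF0 (by omega) (by rw [Finset.mem_range] at hx; omega)
        (by rw [Finset.mem_range] at hx; omega)]
      simp

end faces

/-! ### The Hilbert function and the shape of the complex -/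

section hilbert
variable {K : Type*} [Field K] {n : ℕ}

open Classical in
/-- The exponents of degree `t` of the monomials with support in `Γ`. -/
def faceExponents (Γ : Set (Finset (Fin n))) (t : ℕ) : Finset (Fin n →₀ ℕ) :=
  (Finset.univ.finsuppAntidiag t).filter fun b => b.support ∈ Γ

theorem mem_faceExponents {Γ : Set (Finset (Fin n))} {t : ℕ} {b : Fin n →₀ ℕ} :
    b ∈ faceExponents Γ t ↔ b.degree = t ∧ b.support ∈ Γ := by
  classical
  simp only [faceExponents, Finset.mem_filter, Finset.mem_finsuppAntidiag, Finsupp.degree_eq_sum,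
    Finset.subset_univ, and_true]

theorem IsFaceSet.hilbertFunction_eq {I : Ideal (MvPolynomial (Fin n) K)}
    {Γ : Set (Finset (Fin n))} (h : IsFaceSet I Γ) (t : ℕ) :
    hilbertFunction I t = (faceExponents Γ t).card := by
  classical
  set v : faceExponents Γ t → MvPolynomial (Fin n) K ⧸ I :=
    fun b => (Ideal.Quotient.mkₐ K I).toLinearMap (monomial b.1 1) with hv
  have hli : LinearIndependent K v := by
    rw [Fintype.linearIndependent_iff]
    intro c hc b
    have h1 : ∑ b : faceExponents Γ t, c b • monomial b.1 (1 : K) ∈ I := by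
      refine Ideal.Quotient.eq_zero_iff_mem.1 (Eq.trans ?_ hc)
      change (Ideal.Quotient.mkₐ K I).toLinearMap _ = _
      rw [map_sum]
      exact Finset.sum_congr rfl fun b _ => map_smul _ _ _
    have h2 := (h.2 _).1 h1 b.1 (mem_faceExponents.1 b.2).2
    rw [coeff_sum, Finset.sum_eq_single_of_mem b (Finset.mem_univ _)] at h2
    · simpa using h2
    · intro b' _ hb'
      rw [coeff_smul, coeff_monomial, if_neg (fun he => hb' (Subtype.ext he)), smul_zero]
  have hspan : gradedPiece I t = Submodule.span K (Set.range v) := by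
    refine le_antisymm ?_ (Submodule.span_le.2 ?_)
    · rintro _ ⟨p, hp, rfl⟩
      rw [p.as_sum, map_sum]
      refine Submodule.sum_mem _ fun b hb => ?_
      have hm : monomial b (coeff b p) = coeff b p • monomial b (1 : K) := by
        rw [smul_monomial, smul_eq_mul, mul_one]
      rw [hm, map_smul]
      refine Submodule.smul_mem _ _ ?_
      by_cases hbΓ : b.support ∈ Γ
      · refine Submodule.subset_span ⟨⟨b, mem_faceExponents.2 ⟨?_, hbΓ⟩⟩, rfl⟩
        exact isHomogeneous_iff_degree.1 hp b (mem_support_iff.1 hb)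
      · have h0 : (Ideal.Quotient.mkₐ K I).toLinearMap (monomial b (1 : K)) = 0 := by
          refine Ideal.Quotient.eq_zero_iff_mem.2 ((h.2 _).2 fun b' hb' => ?_)
          rw [coeff_monomial, if_neg]
          rintro rfl
          exact hbΓ hb'
        rw [h0]
        exact Submodule.zero_mem _
    · rintro _ ⟨b, rfl⟩
      exact ⟨_, isHomogeneous_monomial _ (mem_faceExponents.1 b.2).1, rfl⟩
  rw [hilbertFunction, hspan, finrank_span_eq_card hli, Fintype.card_coe]

/-- A squarefree monomial ideal whose Hilbert function has the values `1` in degree `0` and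
`n + k (m - 1)` in degrees `m > 0` belongs to a graph. -/
theorem IsFaceSet.isGraphIdeal {I : Ideal (MvPolynomial (Fin n) K)}
    {Γ : Set (Finset (Fin n))} (h : IsFaceSet I Γ) {k : ℕ} (h0 : hilbertFunction I 0 = 1)
    (hpos : ∀ m, hilbertFunction I (m + 1) = n + k * m) : IsGraphIdeal I Γ := by
  classical
  refine ⟨h, ?_, ?_, ?_⟩
  · rw [h.hilbertFunction_eq] at h0
    obtain ⟨b, hb⟩ := Finset.card_pos.1 (by omega : 0 < (faceExponents Γ 0).card)
    rw [mem_faceExponents, Finsupp.degree_eq_zero_iff] at hb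
    obtain ⟨rfl, hb⟩ := hb
    simpa using hb
  · intro v
    by_contra hv
    have h1 := hpos 0
    rw [h.hilbertFunction_eq, mul_zero, add_zero, zero_add] at h1
    -- Without the vertex `v` at most `n - 1` variables survive in degree one, fewer than the
    -- prescribed `n`.
    have hsub : faceExponents Γ 1 ⊆
        (Finset.univ.erase v).image fun u => Finsupp.single u 1 := by
      intro b hb
      rw [mem_faceExponents] at hb
      obtain ⟨u, rfl⟩ : ∃ u, b = Finsupp.single u 1 := by
        obtain ⟨u, hu⟩ : ∃ u, b u ≠ 0 := by
          by_contra hcon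
          push Not at hcon
          have : b = 0 := Finsupp.ext hcon
          rw [this] at hb
          simp at hb
        have hle : Finsupp.single u 1 ≤ b := by rw [Finsupp.single_le_iff]; omega
        refine ⟨u, ?_⟩
        have hd := hb.1
        rw [← tsub_add_cancel_of_le hle, map_add, Finsupp.degree_single] at hd
        have hz := (Finsupp.degree_eq_zero_iff _).1 (by omega : (b - Finsupp.single u 1).degree = 0)
        rw [← tsub_add_cancel_of_le hle, hz, zero_add]
      refine Finset.mem_image.2 ⟨u, Finset.mem_erase.2 ⟨?_, Finset.mem_univ _⟩, rfl⟩
      rintro rfl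
      exact hv (by simpa [Finsupp.support_single] using hb.2)
    have h2 := (Finset.card_le_card hsub).trans Finset.card_image_le
    rw [Finset.card_erase_of_mem (Finset.mem_univ _), Finset.card_univ, Fintype.card_fin] at h2
    have := v.pos
    omega
  · intro F hF
    by_contra hcard
    obtain ⟨u, v, w, huv, huw, hvw, hsub⟩ : ∃ u v w, u ≠ v ∧ u ≠ w ∧ v ≠ w ∧ {u, v, w} ⊆ F := by
      obtain ⟨T, hTF, hT⟩ := Finset.exists_subset_card_eq (show 3 ≤ F.card by omega)
      obtain ⟨u, v, w, h1, h2, h3, rfl⟩ := Finset.card_eq_three.1 hT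
      exact ⟨u, v, w, h1, h2, h3, hTF⟩
    -- A face with three vertices carries at least `m * m` monomials of degree `2 * m`. This `m`
    -- makes that count exceed the linear value `n + k * (2 * m - 1)`.
    set m := n + 2 * k + 1 with hm
    set f : ℕ × ℕ → (Fin n →₀ ℕ) := fun p =>
      Finsupp.single u p.1 + Finsupp.single v p.2 + Finsupp.single w (2 * m - p.1 - p.2) with hf
    have hmaps : ∀ p ∈ Finset.range m ×ˢ Finset.range m, f p ∈ faceExponents Γ (2 * m) := by
      rintro ⟨a, b⟩ hp
      simp only [Finset.mem_product, Finset.mem_range] at hp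
      rw [mem_faceExponents]
      refine ⟨?_, h.1 _ hF _ (Finset.Subset.trans ?_ hsub)⟩
      · simp only [hf, map_add, Finsupp.degree_single]
        omega
      · intro x hx
        simp only [hf, Finsupp.mem_support_iff, Finsupp.add_apply, Finsupp.single_apply] at hx
        simp only [Finset.mem_insert, Finset.mem_singleton]
        by_contra hcon
        push Not at hcon
        rw [if_neg hcon.1.symm, if_neg hcon.2.1.symm, if_neg hcon.2.2.symm] at hx
        exact hx rfl
    have hinj : Set.InjOn f (Finset.range m ×ˢ Finset.range m : Finset (ℕ × ℕ)) := by
      rintro ⟨a, b⟩ _ ⟨a', b'⟩ _ he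
      have e1 := DFunLike.congr_fun he u
      have e2 := DFunLike.congr_fun he v
      simp [hf, huv, huw, hvw, huv.symm] at e1 e2
      rw [e1, e2]
    have hle := Finset.card_le_card_of_injOn f hmaps hinj
    rw [Finset.card_product, Finset.card_range, ← h.hilbertFunction_eq,
      show 2 * m = (2 * m - 1) + 1 by omega, hpos] at hle
    have h3 : k * (2 * m - 1) ≤ k * (2 * m) := Nat.mul_le_mul_left _ (by omega)
    have h4 : m * m = m * n + k * (2 * m) + m := by
      rw [hm]; ring
    have h5 : n ≤ m * n := Nat.le_mul_of_pos_left _ (by omega)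
    omega

end hilbert

/-! ### Graphs: faces, Hilbert function and f-vector -/

section graphFaces
variable {n : ℕ}

/-- The faces of a graph, including the empty set. -/
def graphFaces (G : SimpleGraph (Fin n)) : Set (Finset (Fin n)) :=
  {F | F = ∅ ∨ F ∈ (graphComplex G).faces}

/-- The edges of a graph as sets of vertices. -/
def edgeFaces (G : SimpleGraph (Fin n)) : Set (Finset (Fin n)) :=
  {s | ∃ u v, G.Adj u v ∧ s = {u, v}}

theorem mem_graphFaces {G : SimpleGraph (Fin n)} {F : Finset (Fin n)} :
    F ∈ graphFaces G ↔ F = ∅ ∨ (∃ v, F = {v}) ∨ F ∈ edgeFaces G := Iff.rfl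

theorem card_of_mem_edgeFaces {G : SimpleGraph (Fin n)} {F : Finset (Fin n)}
    (h : F ∈ edgeFaces G) : F.card = 2 := by
  obtain ⟨u, v, h, rfl⟩ := h
  exact Finset.card_pair h.ne

theorem pair_mem_graphFaces {G : SimpleGraph (Fin n)} {u v : Fin n} (huv : u ≠ v) :
    {u, v} ∈ graphFaces G ↔ G.Adj u v := by
  rw [mem_graphFaces]
  constructor
  · rintro (h | ⟨w, h⟩ | ⟨a, b, hab, h⟩)
    · exact absurd h (Finset.insert_ne_empty _ _)
    · have := congrArg Finset.card h
      rw [Finset.card_pair huv, Finset.card_singleton] at this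
      omega
    · have hu : u ∈ ({a, b} : Finset (Fin n)) := h ▸ by simp
      have hv : v ∈ ({a, b} : Finset (Fin n)) := h ▸ by simp
      simp only [Finset.mem_insert, Finset.mem_singleton] at hu hv
      rcases hu with rfl | rfl <;> rcases hv with rfl | rfl
      · exact absurd rfl huv
      · exact hab
      · exact hab.symm
      · exact absurd rfl huv
  · intro h
    exact Or.inr (Or.inr ⟨u, v, h, rfl⟩)

theorem card_le_of_mem_graphFaces {G : SimpleGraph (Fin n)} {F : Finset (Fin n)}
    (h : F ∈ graphFaces G) : F.card ≤ 2 := by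
  rcases mem_graphFaces.1 h with rfl | ⟨v, rfl⟩ | h
  · simp
  · simp
  · exact (card_of_mem_edgeFaces h).le

theorem isGraphIdeal_stanleyReisnerIdeal (K : Type*) [Field K] (G : SimpleGraph (Fin n)) :
    IsGraphIdeal (stanleyReisnerIdeal K (graphComplex G)) (graphFaces G) := by
  have hset : graphFaces G =
      {F | ∀ s ∈ {s : Finset (Fin n) | s.Nonempty ∧ s ∉ (graphComplex G).faces}, ¬ s ⊆ F} := by
    ext F
    constructor
    · rintro (rfl | hF) s ⟨hs, hsn⟩ hsF
      · exact hs.ne_empty (Finset.subset_empty.1 hsF)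
      · exact hsn (((graphComplex G).isRelLowerSet_faces hF).2 hsF hs)
    · intro hF
      by_contra hcon
      rw [graphFaces, Set.mem_ofPred_eq, not_or] at hcon
      exact hF F ⟨Finset.nonempty_iff_ne_empty.2 hcon.1, hcon.2⟩ subset_rfl
  refine ⟨?_, Or.inl rfl, fun v => Or.inr (Or.inl ⟨v, rfl⟩), fun F => card_le_of_mem_graphFaces⟩
  rw [hset]
  exact isFaceSet_span _

theorem card_filter_support_singleton {Γ : Set (Finset (Fin n))} {v : Fin n} (hv : {v} ∈ Γ)
    (m : ℕ) : ((faceExponents Γ (m + 1)).filter fun b => b.support = {v}).card = 1 := by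
  rw [Finset.card_eq_one]
  refine ⟨Finsupp.single v (m + 1), ?_⟩
  ext b
  rw [Finset.mem_filter, mem_faceExponents, Finset.mem_singleton]
  constructor
  · rintro ⟨⟨hd, _⟩, hs⟩
    rw [Finsupp.degree_apply, hs, Finset.sum_singleton] at hd
    rw [← hd]
    exact (Finsupp.support_eq_singleton.1 hs).2
  · rintro rfl
    have hs : (Finsupp.single v (m + 1)).support = {v} := Finsupp.support_single _ (by omega)
    rw [hs, Finsupp.degree_single]
    exact ⟨⟨rfl, hv⟩, rfl⟩

theorem card_filter_support_pair {Γ : Set (Finset (Fin n))} {u v : Fin n} (huv : u ≠ v)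
    (h : {u, v} ∈ Γ) (m : ℕ) :
    ((faceExponents Γ (m + 1)).filter fun b => b.support = {u, v}).card = m := by
  classical
  have himg : ((faceExponents Γ (m + 1)).filter fun b => b.support = {u, v}) =
      (Finset.range m).image
        fun i => Finsupp.single u (i + 1) + Finsupp.single v (m - i) := by
    ext b
    rw [Finset.mem_filter, mem_faceExponents, Finset.mem_image]
    constructor
    · rintro ⟨⟨hd, _⟩, hs⟩
      rw [Finsupp.degree_apply, hs, Finset.sum_pair huv] at hd
      have hu : b u ≠ 0 := Finsupp.mem_support_iff.1 (hs ▸ by simp)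
      have hv : b v ≠ 0 := Finsupp.mem_support_iff.1 (hs ▸ by simp)
      refine ⟨b u - 1, Finset.mem_range.2 (by omega), ?_⟩
      ext x
      rw [Finsupp.add_apply, Finsupp.single_apply, Finsupp.single_apply]
      by_cases hxu : u = x
      · subst hxu
        rw [if_pos rfl, if_neg huv.symm]; omega
      · by_cases hxv : v = x
        · subst hxv
          rw [if_neg hxu, if_pos rfl]; omega
        · rw [if_neg hxu, if_neg hxv]
          have : x ∉ b.support := by
            rw [hs]; simp [Ne.symm hxu, Ne.symm hxv]
          simpa using (Finsupp.notMem_support_iff.1 this).symm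
    · rintro ⟨i, hi, rfl⟩
      rw [Finset.mem_range] at hi
      have hs : (Finsupp.single u (i + 1) + Finsupp.single v (m - i)).support = {u, v} := by
        ext x
        rw [Finsupp.mem_support_iff, Finsupp.add_apply, Finsupp.single_apply, Finsupp.single_apply,
          Finset.mem_insert, Finset.mem_singleton, eq_comm (a := x), eq_comm (a := x)]
        split_ifs with h1 h2 h2 <;> (simp [h1, h2]; try omega)
      rw [hs, map_add, Finsupp.degree_single, Finsupp.degree_single]
      exact ⟨⟨by omega, h⟩, rfl⟩
  rw [himg, Finset.card_image_of_injective, Finset.card_range]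
  intro i j hij
  have := DFunLike.congr_fun hij u
  simpa [huv.symm] using this

/-- A vertex supports one monomial of degree `m + 1`; an edge supports `m`, since both exponents are
positive. -/
theorem card_faceExponents_graphFaces (G : SimpleGraph (Fin n)) (m : ℕ) :
    (faceExponents (graphFaces G) (m + 1)).card = n + (edgeFaces G).ncard * m := by
  classical
  have hfin : (edgeFaces G).Finite := Set.toFinite _
  set V : Finset (Finset (Fin n)) := Finset.univ.image fun v => {v} with hV
  have hdisj : Disjoint V hfin.toFinset := by
    rw [Finset.disjoint_left]
    intro F hF hE
    obtain ⟨v, _, rfl⟩ := Finset.mem_image.1 hF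
    have := card_of_mem_edgeFaces (hfin.mem_toFinset.1 hE)
    rw [Finset.card_singleton] at this
    omega
  have hmaps : ∀ b ∈ faceExponents (graphFaces G) (m + 1), b.support ∈ V ∪ hfin.toFinset := by
    intro b hb
    rw [mem_faceExponents, mem_graphFaces] at hb
    rw [Finset.mem_union, hfin.mem_toFinset]
    obtain ⟨hd, h | ⟨v, h⟩ | h⟩ := hb
    · rw [Finsupp.support_eq_empty] at h
      rw [h, map_zero] at hd
      omega
    · exact Or.inl (Finset.mem_image.2 ⟨v, Finset.mem_univ _, h.symm⟩)
    · exact Or.inr h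
  rw [Finset.card_eq_sum_card_fiberwise hmaps, Finset.sum_union hdisj, hV,
    Finset.sum_image (fun a _ b _ h => Finset.singleton_injective h)]
  congr 1
  · rw [Finset.sum_congr rfl fun v _ => card_filter_support_singleton
      (Γ := graphFaces G) (Or.inr (Or.inl ⟨v, rfl⟩)) m]
    simp
  · rw [Set.ncard_eq_toFinset_card _ hfin, ← smul_eq_mul, ← Finset.sum_const]
    refine Finset.sum_congr rfl fun F hF => ?_
    obtain ⟨u, v, h, rfl⟩ := hfin.mem_toFinset.1 hF
    exact card_filter_support_pair h.ne ((pair_mem_graphFaces h.ne).2 h) m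

theorem card_faceExponents_zero {Γ : Set (Finset (Fin n))} (h0 : ∅ ∈ Γ) :
    (faceExponents Γ 0).card = 1 := by
  rw [Finset.card_eq_one]
  refine ⟨0, ?_⟩
  ext b
  rw [mem_faceExponents, Finset.mem_singleton, Finsupp.degree_eq_zero_iff]
  constructor
  · exact fun h => h.1
  · rintro rfl
    exact ⟨rfl, by simpa using h0⟩

theorem hilbertOfFVector_nkVector_zero (n k : ℕ) : hilbertOfFVector (nkVector n k) 0 = 1 := by
  simp [hilbertOfFVector]

/-- The entry `k` sits at index `1`, which exists only for `n ≥ 2`; this explains the hypothesis. -/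
theorem hilbertOfFVector_nkVector_succ {n k : ℕ} (h : k = 0 ∨ 2 ≤ n) (m : ℕ) :
    hilbertOfFVector (nkVector n k) (m + 1) = n + k * m := by
  unfold hilbertOfFVector nkVector
  rw [if_neg (by omega), Nat.add_sub_cancel]
  match n with
  | 0 => simp; omega
  | 1 =>
    have hk : k = 0 := by omega
    simp [hk]
  | n + 2 =>
    rw [Fin.sum_univ_succ, Fin.sum_univ_succ, Finset.sum_eq_zero]
    · simp
    · intro i _
      simp

theorem hilbertFunction_graph (K : Type*) [Field K] (G : SimpleGraph (Fin n)) {k : ℕ}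
    (hG : (edgeFaces G).ncard = k) (h : k = 0 ∨ 2 ≤ n) :
    hilbertFunction (stanleyReisnerIdeal K (graphComplex G)) =
      hilbertOfFVector (nkVector n k) := by
  have hI := isGraphIdeal_stanleyReisnerIdeal K G
  funext m
  rw [hI.isFaceSet.hilbertFunction_eq]
  cases m with
  | zero => rw [card_faceExponents_zero hI.empty_mem, hilbertOfFVector_nkVector_zero]
  | succ m => rw [card_faceExponents_graphFaces, hG, hilbertOfFVector_nkVector_succ h]

theorem fVector_graph (G : SimpleGraph (Fin n)) {k : ℕ} (hG : (edgeFaces G).ncard = k) :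
    fVector (graphComplex G) = nkVector n k := by
  funext i
  unfold fVector nkVector
  split_ifs with h0 h1
  · have : {s : Finset (Fin n) | s ∈ (graphComplex G).faces ∧ s.card = i.val + 1} =
        Set.range fun v : Fin n => ({v} : Finset (Fin n)) := by
      ext s
      constructor
      · rintro ⟨_, hs⟩
        rw [h0] at hs
        obtain ⟨v, rfl⟩ := Finset.card_eq_one.1 hs
        exact ⟨v, rfl⟩
      · rintro ⟨v, rfl⟩
        exact ⟨Or.inl ⟨v, rfl⟩, by simp [h0]⟩
    rw [this, ← Set.image_univ, Set.ncard_image_of_injective _ Finset.singleton_injective,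
      Set.ncard_univ, Nat.card_fin]
  · have : {s : Finset (Fin n) | s ∈ (graphComplex G).faces ∧ s.card = i.val + 1} =
        edgeFaces G := by
      ext s
      constructor
      · rintro ⟨⟨v, rfl⟩ | hs, hc⟩
        · rw [Finset.card_singleton] at hc; omega
        · exact hs
      · intro hs
        exact ⟨Or.inr hs, by rw [card_of_mem_edgeFaces hs, h1]⟩
    rw [this, hG]
  · rw [Set.ncard_eq_zero (Set.toFinite _), Set.eq_empty_iff_forall_notMem]
    rintro s ⟨hs, hc⟩
    have := card_le_of_mem_graphFaces (G := G) (Or.inr hs)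
    omega

theorem hasLeastGradedBetti_graph {K : Type*} [Field K] (G : SimpleGraph (Fin n))
    (h : (edgeFaces G).ncard = 0 ∨ 2 ≤ n)
    (hlin : ∀ i, KoszulExact (stanleyReisnerIdeal K (graphComplex G)) (i + 1) (i + 2) ∨
      KoszulExact (stanleyReisnerIdeal K (graphComplex G)) i (i + 2)) :
    HasLeastGradedBetti (stanleyReisnerIdeal K (graphComplex G)) := by
  refine ⟨⟨_, rfl⟩, fun J hJ hH i j => ?_⟩
  obtain ⟨Γ, hΓ⟩ := hJ.exists_isFaceSet
  have hH' := hilbertFunction_graph K G rfl h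
  refine (isGraphIdeal_stanleyReisnerIdeal K G).gradedBetti_le hlin
    (hΓ.isGraphIdeal (k := (edgeFaces G).ncard) ?_ fun m => ?_) hH i j
  · rw [hH, hH', hilbertOfFVector_nkVector_zero]
  · rw [hH, hH', hilbertOfFVector_nkVector_succ h]

end graphFaces

/-! ### The path -/

section path
variable {n : ℕ}

theorem ncard_edgeFaces_path {k : ℕ} (hk : k < n) :
    (edgeFaces (pathWithEdges n k)).ncard = k := by
  have himg : edgeFaces (pathWithEdges n k) = Set.range fun i : Fin k =>
      ({⟨i, by omega⟩, ⟨i + 1, by omega⟩} : Finset (Fin n)) := by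
    ext s
    constructor
    · rintro ⟨u, v, h | h, rfl⟩
      · have hv : (⟨u + 1, by omega⟩ : Fin n) = v := Fin.ext h.1
        exact ⟨⟨u, by omega⟩, congrArg (fun x => ({u, x} : Finset (Fin n))) hv⟩
      · have hu : (⟨v + 1, by omega⟩ : Fin n) = u := Fin.ext h.1
        rw [Finset.pair_comm]
        exact ⟨⟨v, by omega⟩, congrArg (fun x => ({v, x} : Finset (Fin n))) hu⟩
    · rintro ⟨i, rfl⟩
      exact ⟨_, _, Or.inl ⟨rfl, Nat.succ_le_of_lt i.2⟩, rfl⟩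
  rw [himg, ← Set.image_univ, Set.ncard_image_of_injective, Set.ncard_univ, Nat.card_fin]
  intro i j hij
  beta_reduce at hij
  have h1 : (⟨i, by omega⟩ : Fin n) ∈ ({⟨j, by omega⟩, ⟨j + 1, by omega⟩} : Finset (Fin n)) := by
    rw [← hij]; simp
  have h2 : (⟨i + 1, by omega⟩ : Fin n) ∈
      ({⟨j, by omega⟩, ⟨j + 1, by omega⟩} : Finset (Fin n)) := by
    rw [← hij]; simp
  simp only [Finset.mem_insert, Finset.mem_singleton, Fin.mk.injEq] at h1 h2
  ext
  omega

/-- Edges join consecutive vertices only, so the partial sums of `c` along the path are a potential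
on every `W`. -/
theorem koszulExact_path (K : Type*) [Field K] (n k i : ℕ) :
    KoszulExact (stanleyReisnerIdeal K (graphComplex (pathWithEdges n k))) i (i + 2) := by
  have hI := isGraphIdeal_stanleyReisnerIdeal K (pathWithEdges n k)
  refine hI.isFaceSet.koszulExact fun W hW => exactAt_of_potential hI.singleton_mem hW ?_
  intro c hc
  set e : ℕ → K := fun m => if h : m + 1 < n then c ⟨m, by omega⟩ ⟨m + 1, h⟩ else 0 with he
  have hstep : ∀ u w : Fin n, u.val + 1 = w.val →
      ∑ m ∈ Finset.range w, e m - ∑ m ∈ Finset.range u, e m = c u w := by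
    intro u w huw
    rw [← huw, Finset.sum_range_succ, add_sub_cancel_left, he]
    have hu : u.val + 1 < n := by omega
    simp only [hu, dif_pos]
    congr
  refine ⟨fun v => ∑ m ∈ Finset.range v, e m, fun u _ w _ huw hF => ?_⟩
  rw [pair_mem_graphFaces huw] at hF
  rcases hF with h | h
  · exact hstep u w h.1
  · rw [hc w u huw.symm, ← hstep w u h.1, neg_sub]

theorem hasLinearResolution_path (K : Type*) [Field K] (n k : ℕ) :
    HasLinearResolution (stanleyReisnerIdeal K (graphComplex (pathWithEdges n k))) 2 := by
  classical
  have hI := isGraphIdeal_stanleyReisnerIdeal K (pathWithEdges n k)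
  refine ⟨⟨{p | ∃ u v : Fin n, u ≠ v ∧ ¬(pathWithEdges n k).Adj u v ∧ p = X u * X v}, ?_, ?_⟩, ?_⟩
  · rintro p ⟨u, v, _, _, rfl⟩
    exact (isHomogeneous_X K u).mul (isHomogeneous_X K v)
  · refine le_antisymm (Ideal.span_le.2 ?_) (Ideal.span_le.2 ?_)
    · rintro _ ⟨s, ⟨hs, hsn⟩, rfl⟩
      obtain ⟨u, hu, v, hv, huv, hadj⟩ : ∃ u ∈ s, ∃ v ∈ s, u ≠ v ∧
          ¬(pathWithEdges n k).Adj u v := by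
        by_contra hcon
        push Not at hcon
        apply hsn
        by_cases h1 : s.card = 1
        · exact Or.inl (Finset.card_eq_one.1 h1)
        · by_cases h2 : s.card = 2
          · obtain ⟨u, v, huv, rfl⟩ := Finset.card_eq_two.1 h2
            exact Or.inr ⟨u, v, hcon u (by simp) v (by simp) huv, rfl⟩
          · exfalso
            have h3 := hs.card_pos
            -- A path has no triangle, so a set of three or more vertices always contains a
            -- non-adjacent pair.
            obtain ⟨T, hT, hT3⟩ := Finset.exists_subset_card_eq (show 3 ≤ s.card by omega)
            obtain ⟨u, v, w, huv, huw, hvw, rfl⟩ := Finset.card_eq_three.1 hT3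
            have hu := hT (show u ∈ ({u, v, w} : Finset (Fin n)) by simp)
            have hv := hT (show v ∈ ({u, v, w} : Finset (Fin n)) by simp)
            have hw := hT (show w ∈ ({u, v, w} : Finset (Fin n)) by simp)
            rcases hcon u hu v hv huv with a | a <;> rcases hcon u hu w hw huw with b | b <;>
              rcases hcon v hv w hw hvw with c | c <;> omega
      beta_reduce
      rw [SetLike.mem_coe, ← Finset.mul_prod_erase s _ hu,
        ← Finset.mul_prod_erase (s.erase u) _ (Finset.mem_erase.2 ⟨huv.symm, hv⟩), ← mul_assoc]
      exact Ideal.mul_mem_right _ _ (Ideal.subset_span ⟨u, v, huv, hadj, rfl⟩)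
    · rintro _ ⟨u, v, huv, hadj, rfl⟩
      refine Ideal.subset_span ⟨{u, v}, ⟨Finset.insert_nonempty _ _, fun h => ?_⟩, ?_⟩
      · exact hadj ((pair_mem_graphFaces huv).1 (Or.inr h))
      · exact Finset.prod_pair huv
  · intro i j h0 h1
    apply gradedBetti_eq_zero
    by_cases hj : j = i + 2
    · subst hj
      exact koszulExact_path K n k i
    · by_cases hj1 : j = i + 1
      · have hi : i = 0 := by omega
        subst hi
        subst hj1
        exact hI.isFaceSet.koszulExact fun W hW =>
          exactAt_zero hI.isFaceSet.1 (Finset.card_pos.1 (by omega))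
      · exact hI.koszulExact h0 hj1 hj

end path

/-! ### The cycle -/

section cycle
variable {n : ℕ}

theorem cycleGraph_adj_iff_val {n : ℕ} (hn : 3 ≤ n) {u v : Fin n} :
    (SimpleGraph.cycleGraph n).Adj u v ↔ u.val + 1 = v.val ∨ v.val + 1 = u.val ∨
      (u.val = 0 ∧ v.val + 1 = n) ∨ (v.val = 0 ∧ u.val + 1 = n) := by
  rw [SimpleGraph.cycleGraph_adj']
  have hval : ∀ a b : Fin n, (a - b).val = if b.val ≤ a.val then a.val - b.val
      else n + a.val - b.val := by
    intro a b
    split_ifs with h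
    · exact Fin.sub_val_of_le h
    · exact Fin.coe_sub_iff_lt.2 (by omega)
  rw [hval, hval]
  split_ifs <;> omega

theorem ncard_edgeFaces_cycle (hn : 3 ≤ n) :
    (edgeFaces (SimpleGraph.cycleGraph n)).ncard = n := by
  have himg : edgeFaces (SimpleGraph.cycleGraph n) = Set.range fun i : Fin n =>
      ({i, if h : i.val + 1 < n then ⟨i.val + 1, h⟩ else ⟨0, by omega⟩} : Finset (Fin n)) := by
    ext s
    constructor
    · rintro ⟨u, v, h, rfl⟩
      rw [cycleGraph_adj_iff_val hn] at h
      have key : ∀ a b : Fin n, (a.val + 1 = b.val ∨ (b.val = 0 ∧ a.val + 1 = n)) →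
          (if h : a.val + 1 < n then (⟨a.val + 1, h⟩ : Fin n) else ⟨0, by omega⟩) = b := by
        intro a b hab
        ext
        split_ifs <;> (simp; try omega)
      by_cases h' : u.val + 1 = v.val ∨ (v.val = 0 ∧ u.val + 1 = n)
      · exact ⟨u, by beta_reduce; rw [key u v h']⟩
      · exact ⟨v, by beta_reduce; rw [key v u (by omega), Finset.pair_comm]⟩
    · rintro ⟨i, rfl⟩
      refine ⟨_, _, ?_, rfl⟩
      rw [cycleGraph_adj_iff_val hn]
      split_ifs <;> (simp; try omega)
  rw [himg, ← Set.image_univ, Set.ncard_image_of_injective, Set.ncard_univ, Nat.card_fin]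
  intro i j hij
  beta_reduce at hij
  set i' : Fin n := if h : i.val + 1 < n then ⟨i.val + 1, h⟩ else ⟨0, by omega⟩ with hi'
  set j' : Fin n := if h : j.val + 1 < n then ⟨j.val + 1, h⟩ else ⟨0, by omega⟩ with hj'
  have h1 : i ∈ ({j, j'} : Finset (Fin n)) := hij ▸ by simp
  have h2 : i' ∈ ({j, j'} : Finset (Fin n)) := hij ▸ by simp
  have hi : i'.val = if i.val + 1 < n then i.val + 1 else 0 := by rw [hi']; split_ifs <;> rfl
  have hj : j'.val = if j.val + 1 < n then j.val + 1 else 0 := by rw [hj']; split_ifs <;> rfl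
  simp only [Finset.mem_insert, Finset.mem_singleton, Fin.ext_iff] at h1 h2
  ext
  split_ifs at hi hj <;> omega

/-- A proper subset `W` misses some vertex `x`, and the cycle cut open at `x` is a path. -/
theorem koszulExact_cycle (K : Type*) [Field K] (hn : 3 ≤ n) {i : ℕ} (hi : i + 2 ≠ n) :
    KoszulExact (stanleyReisnerIdeal K (graphComplex (SimpleGraph.cycleGraph n))) i (i + 2) := by
  have hI := isGraphIdeal_stanleyReisnerIdeal K (SimpleGraph.cycleGraph n)
  refine hI.isFaceSet.koszulExact fun W hW => exactAt_of_potential hI.singleton_mem hW ?_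
  intro c hc
  obtain ⟨x, hx⟩ : ∃ x, x ∉ W := by
    by_contra hcon
    push Not at hcon
    rw [Finset.eq_univ_of_forall hcon, Finset.card_univ, Fintype.card_fin] at hW
    exact hi hW.symm
  set e : ℕ → K := fun m => if h : m + 1 < n then c ⟨m, by omega⟩ ⟨m + 1, h⟩ else 0 with he
  -- The defect of the partial sums on the closing edge. It is added as a jump at `x`: no edge
  -- between consecutive vertices of `W` crosses `x`, while the closing edge has its ends on
  -- opposite sides of the jump.
  set δ : K := c ⟨0, by omega⟩ ⟨n - 1, by omega⟩ - ∑ m ∈ Finset.range (n - 1), e m with hδ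
  set f : Fin n → K := fun v => ∑ m ∈ Finset.range v, e m + if x < v then δ else 0 with hf
  have hstep : ∀ u ∈ W, ∀ w ∈ W, u.val + 1 = w.val → f w - f u = c u w := by
    intro u hu w hw huw
    have hxu : x ≠ u := by rintro rfl; exact hx hu
    have hiff : x < w ↔ x < u := by
      rw [Fin.lt_def, Fin.lt_def]
      have : x.val ≠ u.val := fun h => hxu (Fin.ext h)
      omega
    rw [hf]
    beta_reduce
    rw [if_congr hiff rfl rfl, ← huw, Finset.sum_range_succ, add_sub_add_right_eq_sub,
      add_sub_cancel_left, he]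
    have hu : u.val + 1 < n := by omega
    simp only [hu, dif_pos]
    congr
  have hwrap : ∀ u ∈ W, ∀ w ∈ W, u.val = 0 ∧ w.val + 1 = n → f w - f u = c u w := by
    intro u hu w hw ⟨hu0, hwn⟩
    have hxw : x < w := by
      have : x.val ≠ w.val := fun h => hx (Fin.ext h ▸ hw)
      rw [Fin.lt_def]; omega
    have hxu : ¬x < u := by rw [Fin.lt_def]; omega
    have hu' : (⟨0, by omega⟩ : Fin n) = u := Fin.ext hu0.symm
    have hw' : (⟨n - 1, by omega⟩ : Fin n) = w := Fin.ext (by simp; omega)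
    rw [hf]
    beta_reduce
    rw [if_pos hxw, if_neg hxu, hδ, hu', hw', hu0, show w.val = n - 1 by omega]
    simp
  refine ⟨f, fun u hu w hw huw hF => ?_⟩
  rw [pair_mem_graphFaces huw, cycleGraph_adj_iff_val hn] at hF
  rcases hF with h | h | h | h
  · exact hstep u hu w hw h
  · rw [hc w u huw.symm, ← hstep w hw u hu h, neg_sub]
  · exact hwrap u hu w hw h
  · rw [hc w u huw.symm, ← hwrap w hw u hu h, neg_sub]

theorem koszulExact_cycle_top (K : Type*) [Field K] (hn : 3 ≤ n) {i : ℕ} (hi : i + 1 = n) :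
    KoszulExact (stanleyReisnerIdeal K (graphComplex (SimpleGraph.cycleGraph n))) i n := by
  have hI := isGraphIdeal_stanleyReisnerIdeal K (SimpleGraph.cycleGraph n)
  refine hI.isFaceSet.koszulExact fun W hW =>
    exactAt_of_connected hI.empty_mem (hW.trans hi.symm) ?_
  intro g hg
  have hWu : W = Finset.univ := (Finset.card_eq_iff_eq_univ W).1 (by simpa using hW)
  subst hWu
  have hall : ∀ m (hm : m < n), g ⟨m, hm⟩ = g ⟨0, by omega⟩ := by
    intro m
    induction m with
    | zero => intro _; rfl
    | succ m ih =>
      intro hm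
      rw [← ih (by omega)]
      refine (hg _ (Finset.mem_univ _) _ (Finset.mem_univ _) ?_ ?_).symm
      · simp
      · rw [pair_mem_graphFaces (by simp), cycleGraph_adj_iff_val hn]
        exact Or.inl rfl
  exact ⟨g ⟨0, by omega⟩, fun u _ => hall u.1 u.2⟩

end cycle

/-! ### Least Betti numbers and distinct Hilbert functions -/

theorem hasLeastGradedBetti_path (K : Type*) [Field K] {n k : ℕ}
    (h : (edgeFaces (pathWithEdges n k)).ncard = 0 ∨ 2 ≤ n) :
    HasLeastGradedBetti (stanleyReisnerIdeal K (graphComplex (pathWithEdges n k))) :=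
  hasLeastGradedBetti_graph _ h fun i => Or.inr (koszulExact_path K n k i)

theorem hasLeastGradedBetti_cycle (K : Type*) [Field K] {n : ℕ} (hn : 3 ≤ n) :
    HasLeastGradedBetti (stanleyReisnerIdeal K (graphComplex (SimpleGraph.cycleGraph n))) := by
  refine hasLeastGradedBetti_graph _ (Or.inr (by omega)) fun i => ?_
  by_cases hi : i + 2 = n
  · rw [hi]
    exact Or.inl (koszulExact_cycle_top K hn (by omega))
  · exact Or.inr (koszulExact_cycle K hn hi)

theorem ncard_hilbertOfFVector_nkVector {n : ℕ} (hn : 2 ≤ n) :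
    {H : ℕ → ℕ | ∃ k : ℕ, k ≤ n ∧ H = hilbertOfFVector (nkVector n k)}.ncard = n + 1 := by
  have himg : {H : ℕ → ℕ | ∃ k : ℕ, k ≤ n ∧ H = hilbertOfFVector (nkVector n k)} =
      (fun k => hilbertOfFVector (nkVector n k)) '' (Finset.range (n + 1) : Set ℕ) := by
    ext H
    simp only [Set.mem_image, Finset.coe_range, Set.mem_Iio, Nat.lt_succ_iff]
    exact exists_congr fun k => and_congr_right fun _ => eq_comm
  rw [himg, Set.ncard_image_of_injective, Set.ncard_coe_finset, Finset.card_range]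
  intro k l hkl
  -- The value at `2` is `n + k`, which determines `k`.
  have h := congrFun hkl 2
  beta_reduce at h
  rw [hilbertOfFVector_nkVector_succ (Or.inr hn), hilbertOfFVector_nkVector_succ (Or.inr hn)] at h
  omega

end

theorem theorem4p4 {K : Type*} [Field K] (n : ℕ) :
    (∀ k : ℕ, k ≤ n → k ≤ n.choose 2 →
      ∃ I : Ideal (MvPolynomial (Fin n) K),
        hilbertFunction I = hilbertOfFVector (nkVector n k) ∧ HasLeastGradedBetti I) ∧
    (∀ k : ℕ, k < n →
      fVector (graphComplex (pathWithEdges n k)) = nkVector n k ∧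
      hilbertFunction (stanleyReisnerIdeal K (graphComplex (pathWithEdges n k))) =
        hilbertOfFVector (nkVector n k) ∧
      HasLinearResolution (stanleyReisnerIdeal K (graphComplex (pathWithEdges n k))) 2 ∧
      HasLeastGradedBetti (stanleyReisnerIdeal K (graphComplex (pathWithEdges n k)))) ∧
    (3 ≤ n →
      fVector (graphComplex (SimpleGraph.cycleGraph n)) = nkVector n n ∧
      hilbertFunction (stanleyReisnerIdeal K (graphComplex (SimpleGraph.cycleGraph n))) =
        hilbertOfFVector (nkVector n n) ∧
      HasLeastGradedBetti (stanleyReisnerIdeal K (graphComplex (SimpleGraph.cycleGraph n)))) ∧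
    (3 ≤ n →
      {H : ℕ → ℕ | ∃ k : ℕ, k ≤ n ∧ H = hilbertOfFVector (nkVector n k)}.ncard = n + 1) := by
  refine ⟨fun k hkn hk => ?_, fun k hk => ?_, fun hn => ?_, fun hn => ?_⟩
  · rcases hkn.lt_or_eq with hlt | rfl
    · have he := ncard_edgeFaces_path hlt
      have h2 : k = 0 ∨ 2 ≤ n := by omega
      exact ⟨_, hilbertFunction_graph K _ he h2, hasLeastGradedBetti_path K (h2.imp_left he.trans)⟩
    · by_cases h3 : 3 ≤ k
      · exact ⟨_, hilbertFunction_graph K _ (ncard_edgeFaces_cycle h3) (Or.inr (by omega)),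
          hasLeastGradedBetti_cycle K h3⟩
      -- The bound `k ≤ k.choose 2` fails for `k = 1` and `k = 2`, so only the empty graph remains.
      · have h0 : k = 0 := by
          interval_cases k <;> simp at hk ⊢
        subst h0
        have he : (edgeFaces (pathWithEdges 0 0)).ncard = 0 := by
          rw [Set.ncard_eq_zero (Set.toFinite _), Set.eq_empty_iff_forall_notMem]
          rintro s ⟨u, _⟩
          exact u.elim0
        exact ⟨_, hilbertFunction_graph K _ he (Or.inl rfl), hasLeastGradedBetti_path K (Or.inl he)⟩
  · have he := ncard_edgeFaces_path hk
    have h2 : k = 0 ∨ 2 ≤ n := by omega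
    exact ⟨fVector_graph _ he, hilbertFunction_graph K _ he h2, hasLinearResolution_path K n k,
      hasLeastGradedBetti_path K (h2.imp_left he.trans)⟩
  · have he := ncard_edgeFaces_cycle hn
    exact ⟨fVector_graph _ he, hilbertFunction_graph K _ he (Or.inr (by omega)),
      hasLeastGradedBetti_cycle K hn⟩
  · exact ncard_hilbertOfFVector_nkVector (by omega)
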